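/- Let $G$ be a finitely generated group, and let $S$ and $T$ be finite generating sets of $G$. Let $\mathrm{Cay}(G,S)$ be the Cayley graph, in which distinct elements $u,v\in G$ are joined by an edge if and only if $v=us$ or $u=vs$ for some $s\in S$, regarded as a topological space (its geometric realization). A proper ray in a space $X$ is a continuous proper map $[0,\infty)\to X$. Two proper rays $r_1,r_2$ in $X$ define the same end if for every compact $K\subset X$ there is $N\in\mathbb{N}$ such that $r_1([N,\infty))$ and $r_2([N,\infty))$ are contained in the same path component of $X\setminus K$. The ends of $X$ are the equivalence classes of proper rays under this relation. $G$ is said to have exactly two ends if $\mathrm{Cay}(G,S)$ has exactly two ends. Equip $G$ with the word metric $d_T(g,h)=|g^{-1}h|_T$, where $|g|_T$ is the least length of a word in the letters $T\cup T^{-1}$ that represents $g$, and equip $\mathbb{Z}$ with the metric $|x-y|$. A (not necessarily continuous) map $f:X\to Y$ between metric spaces is coarse if there is a non-decreasing function $\sigma:[0,\infty)\to[0,\infty)$ with $d_Y(f(x),f(y))\le\sigma(d_X(x,y))$ for all $x,y\in X$, and $f^{-1}(B)$ is bounded for every bounded $B\subset Y$. The spaces $X$ and $Y$ are coarsely equivalent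 if there are coarse maps $f:X\to Y$ and $g:Y\to X$ such that $\sup_{x\in X} d_X(g(f(x)),x)<\infty$ and $\sup_{y\in Y} d_Y(f(g(y)),y)<\infty$. Then $G$ has exactly two ends if and only if $(G,d_T)$ is coarsely equivalent to $\mathbb{Z}$. -/

import Mathlib

open scoped NNReal

/-! ### Coarse equivalence of metric spaces -/

section Coarse

variable {X Y : Type*} [MetricSpace X] [MetricSpace Y]

/-- `f` is uniformly expansive: `d (f x) (f y) ≤ σ (d x y)` for some non-decreasing
`σ : [0, ∞) → [0, ∞)`. -/
def UniformlyExpansive (f : X → Y) : Prop :=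
  ∃ σ : ℝ≥0 → ℝ≥0, Monotone σ ∧ ∀ x y : X, nndist (f x) (f y) ≤ σ (nndist x y)

/-- `f` is metrically proper: preimages of bounded sets are bounded. -/
def MetricallyProper (f : X → Y) : Prop :=
  ∀ B : Set Y, Bornology.IsBounded B → Bornology.IsBounded (f ⁻¹' B)

/-- A coarse map: a (not necessarily continuous) uniformly expansive and metrically proper map. -/
def IsCoarseMap (f : X → Y) : Prop :=
  UniformlyExpansive f ∧ MetricallyProper f

/-- Two maps are close if they are at bounded distance from each other. -/
def CloseMaps (f g : X → Y) : Prop :=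
  ∃ r : ℝ, 0 < r ∧ ∀ x : X, dist (f x) (g x) < r

/-- A coarse equivalence: a coarse map with a coarse inverse up to closeness. -/
def IsCoarseEquivalence (f : X → Y) : Prop :=
  IsCoarseMap f ∧ ∃ g : Y → X, IsCoarseMap g ∧ CloseMaps (g ∘ f) id ∧ CloseMaps (f ∘ g) id

variable (X Y) in
/-- `X` and `Y` are coarsely equivalent. -/
def CoarselyEquivalent : Prop :=
  ∃ f : X → Y, IsCoarseEquivalence f

end Coarse

/-! ### The word metric -/

section WordMetric

variable {G : Type*} [Group G]

/-- `l` is a word in the letters `S ∪ S⁻¹` that represents `g`. -/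
def IsWordFor (S : Set G) (g : G) (l : List G) : Prop :=
  (∀ x ∈ l, x ∈ S ∨ x⁻¹ ∈ S) ∧ l.prod = g

/-- The word length of `g`: the least length of a word in `S ∪ S⁻¹` that represents `g`
(such a word exists if `S` generates the group). -/
noncomputable def wordLength (S : Set G) (g : G) : ℕ :=
  sInf {n : ℕ | ∃ l : List G, IsWordFor S g l ∧ l.length = n}

theorem wordLength_le {S : Set G} {g : G} {l : List G} (h : IsWordFor S g l) :
    wordLength S g ≤ l.length :=
  Nat.sInf_le ⟨l, h, rfl⟩

theorem exists_isWordFor {S : Set G} (hS : Subgroup.closure S = ⊤) (g : G) :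
    ∃ l : List G, IsWordFor S g l ∧ l.length = wordLength S g := by
  have hne : {n : ℕ | ∃ l : List G, IsWordFor S g l ∧ l.length = n}.Nonempty := by
    have hg : g ∈ (Subgroup.closure S).toSubmonoid := by
      rw [hS]; exact Subgroup.mem_top g
    rw [Subgroup.closure_toSubmonoid] at hg
    obtain ⟨l, hl, hprod⟩ := Submonoid.exists_list_of_mem_closure hg
    exact ⟨l.length, l, ⟨fun x hx => by simpa using hl x hx, hprod⟩, rfl⟩
  exact Nat.sInf_mem hne

theorem wordLength_one (S : Set G) : wordLength S (1 : G) = 0 :=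
  Nat.le_zero.mp (wordLength_le (l := []) ⟨by simp, by simp⟩)

theorem wordLength_inv_le {S : Set G} (hS : Subgroup.closure S = ⊤) (g : G) :
    wordLength S g⁻¹ ≤ wordLength S g := by
  obtain ⟨l, ⟨hl, hprod⟩, hlen⟩ := exists_isWordFor hS g
  have h : IsWordFor S g⁻¹ (l.map (fun x => x⁻¹)).reverse := by
    refine ⟨fun x hx => ?_, ?_⟩
    · simp only [List.mem_reverse, List.mem_map] at hx
      obtain ⟨y, hy, rfl⟩ := hx
      have := hl y hy
      rw [inv_inv]
      exact this.symm
    · rw [← List.prod_inv_reverse, hprod]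
  simpa [hlen] using wordLength_le h

theorem wordLength_mul_le {S : Set G} (hS : Subgroup.closure S = ⊤) (g h : G) :
    wordLength S (g * h) ≤ wordLength S g + wordLength S h := by
  obtain ⟨l, ⟨hl, hprod⟩, hlen⟩ := exists_isWordFor hS g
  obtain ⟨m, ⟨hm, hprod'⟩, hlen'⟩ := exists_isWordFor hS h
  have hw : IsWordFor S (g * h) (l ++ m) := by
    refine ⟨fun x hx => ?_, by rw [List.prod_append, hprod, hprod']⟩
    rcases List.mem_append.mp hx with hx | hx
    · exact hl x hx
    · exact hm x hx
  simpa [hlen, hlen'] using wordLength_le hw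

theorem eq_one_of_wordLength_eq_zero {S : Set G} (hS : Subgroup.closure S = ⊤) {g : G}
    (hg : wordLength S g = 0) : g = 1 := by
  obtain ⟨l, ⟨_, hprod⟩, hlen⟩ := exists_isWordFor hS g
  rw [hg, List.length_eq_zero_iff] at hlen
  rw [← hprod, hlen, List.prod_nil]

/-- The (left-invariant) word metric `d (g, h) = |g⁻¹ h|` on `G`. -/
noncomputable abbrev wordMetric (S : Set G) (hS : Subgroup.closure S = ⊤) : MetricSpace G where
  dist g h := (wordLength S (g⁻¹ * h) : ℝ)
  dist_self g := by
    rw [inv_mul_cancel, wordLength_one, Nat.cast_zero]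
  dist_comm g h := by
    have h1 := wordLength_inv_le hS (g⁻¹ * h)
    have h2 := wordLength_inv_le hS (h⁻¹ * g)
    rw [mul_inv_rev, inv_inv] at h1 h2
    exact congrArg _ (le_antisymm h2 h1)
  dist_triangle g h k := by
    have h1 := wordLength_mul_le hS (g⁻¹ * h) (h⁻¹ * k)
    rw [mul_assoc, mul_inv_cancel_left] at h1
    exact_mod_cast h1
  eq_of_dist_eq_zero {g h} hgh := by
    have hgh' : (wordLength S (g⁻¹ * h) : ℝ) = 0 := hgh
    exact inv_mul_eq_one.mp (eq_one_of_wordLength_eq_zero hS (by exact_mod_cast hgh'))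

/-- The group `G`, regarded as a metric space with the word metric of the generating set `S`. -/
def WordMetricSpace (S : Set G) (_hS : Subgroup.closure S = ⊤) : Type _ := G

noncomputable instance (S : Set G) (hS : Subgroup.closure S = ⊤) :
    MetricSpace (WordMetricSpace S hS) :=
  (wordMetric S hS : MetricSpace G)

end WordMetric

/-! ### Ends of a space through proper rays -/

section Ends

variable (X : Type*) [TopologicalSpace X]

/-- A proper ray in `X`: a (continuous) proper map `[0, ∞) → X`. -/
def ProperRay : Type _ := {r : ℝ≥0 → X // IsProperMap r}

variable {X}

/-- Two proper rays define the same end if for every compact `K` there is `N : ℕ` such that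
`r₁ [N, ∞)` and `r₂ [N, ∞)` lie in the same path component of the complement of `K`. -/
def SameEnd (r₁ r₂ : ProperRay X) : Prop :=
  ∀ K : Set X, IsCompact K → ∃ N : ℕ, ∃ p ∈ Kᶜ,
    r₁.1 '' Set.Ici (N : ℝ≥0) ⊆ pathComponentIn Kᶜ p ∧
    r₂.1 '' Set.Ici (N : ℝ≥0) ⊆ pathComponentIn Kᶜ p

theorem SameEnd.refl (r : ProperRay X) : SameEnd r r := by
  intro K hK
  have hb : BddAbove (r.1 ⁻¹' K) := (r.2.isCompact_preimage hK).bddAbove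
  obtain ⟨b, hb⟩ := hb
  obtain ⟨N, hN⟩ := exists_nat_gt b
  have hout : r.1 '' Set.Ici (N : ℝ≥0) ⊆ Kᶜ := by
    rintro _ ⟨t, ht, rfl⟩ hmem
    exact absurd (hb hmem) (not_le.mpr (lt_of_lt_of_le hN ht))
  have hconv : IsPathConnected (Set.Ici (N : ℝ≥0)) := by
    have h : Set.Ici (N : ℝ≥0) = (fun x : ℝ≥0 => (N : ℝ≥0) + x) '' Set.univ := by
      ext x
      simp only [Set.mem_Ici, Set.image_univ, Set.mem_range]
      exact ⟨fun hx => ⟨x - N, add_tsub_cancel_of_le hx⟩, fun ⟨y, hy⟩ => hy ▸ le_self_add⟩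
    have huniv : IsPathConnected (Set.univ : Set ℝ≥0) := by
      have : (Set.univ : Set ℝ≥0) = Real.toNNReal '' Set.univ :=
        (Set.image_univ_of_surjective (f := Real.toNNReal) fun x => ⟨x, Real.toNNReal_coe⟩).symm
      rw [this]
      exact isPathConnected_univ.image continuous_real_toNNReal
    rw [h]
    exact huniv.image (by fun_prop)
  have hpc : IsPathConnected (r.1 '' Set.Ici (N : ℝ≥0)) := hconv.image r.2.continuous
  have hp : r.1 N ∈ r.1 '' Set.Ici (N : ℝ≥0) := ⟨N, Set.self_mem_Ici, rfl⟩
  have hsub := hpc.subset_pathComponentIn hp hout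
  exact ⟨N, r.1 N, hout hp, hsub, hsub⟩

theorem SameEnd.symm {r₁ r₂ : ProperRay X} (h : SameEnd r₁ r₂) : SameEnd r₂ r₁ := by
  intro K hK
  obtain ⟨N, p, hp, h1, h2⟩ := h K hK
  exact ⟨N, p, hp, h2, h1⟩

theorem SameEnd.trans {r₁ r₂ r₃ : ProperRay X} (h : SameEnd r₁ r₂) (h' : SameEnd r₂ r₃) :
    SameEnd r₁ r₃ := by
  intro K hK
  obtain ⟨N, p, hp, h1, h2⟩ := h K hK
  obtain ⟨M, q, _, h3, h4⟩ := h' K hK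
  have hN : (N : ℝ≥0) ≤ (max N M : ℕ) := by exact_mod_cast le_max_left N M
  have hM : (M : ℝ≥0) ≤ (max N M : ℕ) := by exact_mod_cast le_max_right N M
  have e1 : JoinedIn Kᶜ p (r₂.1 (max N M : ℕ)) := h2 ⟨_, hN, rfl⟩
  have e2 : JoinedIn Kᶜ q (r₂.1 (max N M : ℕ)) := h3 ⟨_, hM, rfl⟩
  refine ⟨max N M, p, hp, ?_, ?_⟩
  · exact (Set.image_mono (Set.Ici_subset_Ici.mpr hN)).trans h1
  · intro y hy
    have e3 : JoinedIn Kᶜ q y := h4 (Set.image_mono (Set.Ici_subset_Ici.mpr hM) hy)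
    exact (e1.trans e2.symm).trans e3

variable (X) in
/-- The equivalence relation "define the same end" on proper rays. -/
def sameEndSetoid : Setoid (ProperRay X) :=
  ⟨SameEnd, SameEnd.refl, SameEnd.symm, SameEnd.trans⟩

variable (X) in
/-- The ends of `X`: equivalence classes of proper rays. -/
def SpaceEnds : Type _ := Quotient (sameEndSetoid X)

end Ends

/-! ### The Cayley graph as a topological space -/

/-- The geometric realization of a graph, in barycentric coordinates: the vertex `v` is the unit
vector `δ_v` of `V → ℝ`, and an edge `{u, v}` is the segment from `δ_u` to `δ_v`. It carries the
topology of pointwise convergence of the coordinates. For a locally finite graph, such as the Cayley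
graph of a finite generating set, this is the CW topology, and also the topology of the path metric
in which every edge has length one. -/
def graphRealization {V : Type*} [DecidableEq V] (Γ : SimpleGraph V) : Set (V → ℝ) :=
  {x | ∃ u v : V, (u = v ∨ Γ.Adj u v) ∧ x ∈ segment ℝ (Pi.single u (1 : ℝ)) (Pi.single v (1 : ℝ))}

open scoped Classical in
/-- The Cayley graph `Cay(G, S)` as a topological space: vertices are the elements of `G`, and
distinct `u`, `v` are joined by an edge if `v = u s` or `u = v s` for some `s ∈ S`. -/
abbrev CayleySpace {G : Type*} [Group G] (S : Set G) : Type _ :=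
  graphRealization (SimpleGraph.mulCayley S)

/-! Both directions work with sets of vertices that have finite boundary. A proper ray eventually
stays on one side of such a set, rays with different ends are separated by one
(`exists_separating_set`), and every infinite one receives a ray (`exists_ray_tendsInto`, by Kőnig's
argument). A two-ended graph therefore has such a set `E` that is infinite and co-infinite. It is
unique up to finite difference and complementation (`finite_symmDiff_of_card_spaceEnds_eq_two`),
because three disjoint infinite sets of this kind would give three ends.

Two ends imply `ℤ`: left translates of `E` are again of this kind, so infinitely many `h` have `h •
E` at finite difference from `E`. Enclose the boundary of `E` in a finite connected set `C` and
choose such an `h` with `h • C` disjoint from `C`. Then `E` and `h • E` are strictly nested, so `z =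
h` or `z = h⁻¹` satisfies `z • E ⊂ E` with finite remainder `D = E \ z • E`. Hence `z` has infinite
order, and the decreasing chain `z ^ n • E` sorts the group into the layers `z ^ n • D`. So finitely
many right translates of an infinite cyclic group cover `G`, and `n ↦ z ^ n` is a coarse
equivalence.

`ℤ` implies two ends: balls of the word metric are finite, so coarse control amounts to control over
finite sets of right displacements, whatever the generating set. For a coarse equivalence `f` with
coarse inverse `g`, the set where `0 ≤ f` has finite boundary and is infinite and co-infinite. Far
out on either side, points are joined far out along the coarse line `g` (`exists_joinedIn_of_le`),
so each side carries one end. -/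

namespace SimpleGraph

/-! ### Boundaries of vertex sets and geodesic paths. -/

variable {V : Type*} {Γ : SimpleGraph V}

/-- The vertices that have a neighbour on the other side of `A`. -/
def vertexBoundary (Γ : SimpleGraph V) (A : Set V) : Set V :=
  {v | ∃ w, Γ.Adj v w ∧ ¬(v ∈ A ↔ w ∈ A)}

theorem mem_iff_mem_of_adj {A : Set V} {v w : V} (h : Γ.Adj v w) (hv : v ∉ Γ.vertexBoundary A) :
    v ∈ A ↔ w ∈ A := by
  by_contra hne
  exact hv ⟨w, h, hne⟩

theorem vertexBoundary_compl (A : Set V) : Γ.vertexBoundary Aᶜ = Γ.vertexBoundary A := by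
  ext v
  simp only [vertexBoundary, Set.mem_ofPred_eq, Set.mem_compl_iff, not_iff_not]

theorem vertexBoundary_inter_subset (A B : Set V) :
    Γ.vertexBoundary (A ∩ B) ⊆ Γ.vertexBoundary A ∪ Γ.vertexBoundary B := by
  rintro v ⟨w, hvw, hne⟩
  by_contra hv
  rw [Set.mem_union, not_or] at hv
  exact hne (and_congr (mem_iff_mem_of_adj hvw hv.1) (mem_iff_mem_of_adj hvw hv.2))

theorem Preconnected.vertexBoundary_inter_nonempty (h : Γ.Preconnected) {A : Set V}
    (hA : A.Nonempty) (hA' : Aᶜ.Nonempty) : (A ∩ Γ.vertexBoundary A).Nonempty := by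
  by_contra hne
  rw [Set.not_nonempty_iff_eq_empty, ← Set.disjoint_iff_inter_eq_empty, Set.disjoint_left] at hne
  obtain ⟨x, hx⟩ := hA
  obtain ⟨y, hy⟩ := hA'
  obtain ⟨p⟩ := h x y
  induction p with
  | nil => exact hy hx
  | cons hadj _ ih => exact ih ((mem_iff_mem_of_adj hadj (hne hx)).1 hx) hy

/-- A connected set of vertices that misses the boundary of `A` lies on one side of `A`. -/
theorem mem_iff_mem_of_induce_preconnected {A C : Set V} (hC : (Γ.induce C).Preconnected)
    (hd : Disjoint C (Γ.vertexBoundary A)) {x y : V} (hx : x ∈ C) (hy : y ∈ C) :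
    x ∈ A ↔ y ∈ A := by
  obtain ⟨p⟩ := hC ⟨x, hx⟩ ⟨y, hy⟩
  suffices ∀ a b : C, (Γ.induce C).Walk a b → (a.1 ∈ A ↔ b.1 ∈ A) from this _ _ p
  intro a b q
  induction q with
  | nil => rfl
  | cons hadj _ ih =>
    rw [← ih]
    exact mem_iff_mem_of_adj hadj (Set.disjoint_left.1 hd (Subtype.coe_prop _))

/-- If `C` contains the boundary of `A`, and the connected set `C'` contains the boundary of `B`,
misses `C` and lies in `A`, then `Aᶜ ∪ C` lies on one side of `B`. -/
theorem subset_or_subset_compl_of_disjoint (hΓ : Γ.Preconnected) {A B C C' : Set V}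
    (hC : (Γ.induce C).Preconnected) (hne : C.Nonempty)
    (hAC : Γ.vertexBoundary A ⊆ C) (hBC : Γ.vertexBoundary B ⊆ C') (hd : Disjoint C C')
    (hA : C' ⊆ A) : Aᶜ ∪ C ⊆ B ∨ Aᶜ ∪ C ⊆ Bᶜ := by
  obtain ⟨c, hc⟩ := hne
  have hCB : ∀ x ∈ C, (x ∈ B ↔ c ∈ B) := fun x hx =>
    mem_iff_mem_of_induce_preconnected hC (hd.mono_right hBC) hx hc
  -- Follow a walk towards `C`. Until it meets `C` it cannot leave `Aᶜ`, and there it meets no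
  -- boundary vertex of `B`, since these lie in `A`; so its side of `B` never changes.
  have key : ∀ x y, Γ.Walk x y → y ∈ C → x ∈ Aᶜ ∪ C → (x ∈ B ↔ c ∈ B) := by
    intro x y p
    induction p with
    | nil => exact fun hx _ => hCB _ hx
    | @cons u v w hadj _ ih =>
      intro hw hu
      by_cases huC : u ∈ C
      · exact hCB u huC
      · have huA : u ∉ A := hu.resolve_right huC
        have hvA : v ∉ A := fun h => huA ((mem_iff_mem_of_adj hadj fun h => huC (hAC h)).2 h)
        rw [mem_iff_mem_of_adj hadj fun h => huA (hA (hBC h))]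
        exact ih hw (Or.inl hvA)
  have all : ∀ x ∈ Aᶜ ∪ C, (x ∈ B ↔ c ∈ B) := fun x hx => by
    obtain ⟨p⟩ := hΓ x c
    exact key x c p hc hx
  by_cases hcB : c ∈ B
  · exact Or.inl fun x hx => (all x hx).2 hcB
  · exact Or.inr fun x hx h => hcB ((all x hx).1 h)

/-- If `x` and `y` lie on different sides of `A`, every walk from `x` to `y` meets the
boundary of `A`. -/
theorem Walk.exists_mem_support_vertexBoundary {A : Set V} {x y : V} (p : Γ.Walk x y)
    (h : ¬(x ∈ A ↔ y ∈ A)) : ∃ v ∈ p.support, v ∈ Γ.vertexBoundary A := by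
  by_contra! hne
  apply h
  clear h
  induction p with
  | nil => rfl
  | cons hadj q ih =>
    rw [mem_iff_mem_of_adj hadj (hne _ (by simp))]
    exact ih fun v hv => hne v (by simp [hv])

theorem Connected.exists_adj_dist_eq_add_one (hΓ : Γ.Connected) {x a : V} (hne : x ≠ a) :
    ∃ y, Γ.Adj x y ∧ Γ.dist x a = Γ.dist y a + 1 := by
  obtain ⟨p, hp⟩ := hΓ.exists_walk_length_eq_dist x a
  cases p with
  | nil => exact absurd rfl hne
  | @cons _ y _ hadj q =>
    refine ⟨y, hadj, le_antisymm ?_ ?_⟩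
    · have h1 := hΓ.dist_triangle (u := x) (v := y) (w := a)
      rw [dist_eq_one_iff_adj.2 hadj] at h1
      omega
    · have := dist_le q
      rw [Walk.length_cons] at hp
      omega

/-- Vertices far from the base point on geodesics towards `A` lie in `A`. -/
theorem Connected.mem_of_dist_eq_add (hΓ : Γ.Connected) {A : Set V} {o : V} {R : ℕ}
    (hR : ∀ b ∈ Γ.vertexBoundary A, Γ.dist o b < R) {a : V} (ha : a ∈ A) :
    ∀ (n : ℕ) (y : V), Γ.dist y a = n → R ≤ Γ.dist o y →
      Γ.dist o a = Γ.dist o y + Γ.dist y a → y ∈ A := by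
  intro n
  induction n with
  | zero =>
    intro y hy _ _
    rwa [hΓ.dist_eq_zero_iff.1 hy]
  | succ n ih =>
    intro y hy hRy hgeo
    have hne : y ≠ a := by
      rintro rfl
      simp at hy
    obtain ⟨y', hadj, hd⟩ := hΓ.exists_adj_dist_eq_add_one hne
    have h1 := hΓ.dist_triangle (u := o) (v := y') (w := a)
    have h2 := hΓ.dist_triangle (u := o) (v := y) (w := y')
    rw [dist_eq_one_iff_adj.2 hadj] at h2
    refine (mem_iff_mem_of_adj hadj fun hb => ?_).2 (ih y' (by omega) (by omega) (by omega))
    exact absurd (hR y hb) (by omega)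

/-- In a connected locally finite graph, every infinite set of vertices with finite boundary
contains a tail of an injective infinite path. -/
theorem Connected.exists_path_eventually_mem (hΓ : Γ.Connected)
    (hfin : ∀ v, (Γ.neighborSet v).Finite) {A : Set V} (hA : A.Infinite)
    (hb : (Γ.vertexBoundary A).Finite) :
    ∃ x : ℕ → V, (∀ k, Γ.Adj (x k) (x (k + 1))) ∧ Function.Injective x ∧
      ∃ N, ∀ k ≥ N, x k ∈ A := by
  obtain ⟨o⟩ := hΓ.nonempty
  -- When `y` is at distance `k` from `o`, `T k y` consists of the vertices of `A` with a geodesic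
  -- from `o` through `y`. Kőnig's argument extends the path so that this set stays infinite.
  let T : ℕ → V → Set V := fun k y => {a ∈ A | Γ.dist o a = k + Γ.dist y a}
  have step : ∀ k y, Γ.dist o y = k → (T k y).Infinite →
      ∃ y', Γ.Adj y y' ∧ Γ.dist o y' = k + 1 ∧ (T (k + 1) y').Infinite := by
    intro k y hy hinf
    have hsub : T k y \ {y} ⊆ ⋃ y' ∈ Γ.neighborSet y, T (k + 1) y' := by
      rintro a ⟨⟨haA, ha⟩, hne⟩
      obtain ⟨y', hadj, hd⟩ := hΓ.exists_adj_dist_eq_add_one (Ne.symm hne : y ≠ a)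
      exact Set.mem_iUnion₂.2 ⟨y', hadj, haA, by omega⟩
    have hinf' : (T k y \ {y}).Infinite := hinf.sdiff (Set.finite_singleton y)
    obtain ⟨y', hadj, hy'⟩ : ∃ y' ∈ Γ.neighborSet y, (T (k + 1) y').Infinite := by
      by_contra! h
      exact hinf' (((hfin y).biUnion h).subset hsub)
    refine ⟨y', hadj, ?_, hy'⟩
    obtain ⟨a, -, ha⟩ := hy'.nonempty
    have h1 := hΓ.dist_triangle (u := o) (v := y') (w := a)
    have h2 := hΓ.dist_triangle (u := o) (v := y) (w := y')
    rw [dist_eq_one_iff_adj.2 hadj] at h2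
    omega
  choose! nxt hadj hdist hinf using step
  let x : ℕ → V := fun k => Nat.rec o nxt k
  have hx : ∀ k, Γ.dist o (x k) = k ∧ (T k (x k)).Infinite := by
    intro k
    induction k with
    | zero =>
      refine ⟨dist_self, ?_⟩
      convert hA using 1
      ext a
      simp [T, x]
    | succ k ih => exact ⟨hdist k _ ih.1 ih.2, hinf k _ ih.1 ih.2⟩
  refine ⟨x, fun k => hadj k _ (hx k).1 (hx k).2, fun i j hij => ?_, ?_⟩
  · rw [← (hx i).1, ← (hx j).1, hij]
  · obtain ⟨R, hR⟩ := (hb.image (Γ.dist o)).bddAbove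
    -- The boundary lies within distance `R` of `o`. From `R + 1` on, `x k` is beyond it and on a
    -- geodesic to a point of `A`.
    refine ⟨R + 1, fun k hk => ?_⟩
    obtain ⟨a, haA, ha⟩ := (hx k).2.nonempty
    refine hΓ.mem_of_dist_eq_add (R := R + 1)
      (fun b hb => Nat.lt_succ_of_le (hR (Set.mem_image_of_mem _ hb))) haA _ _ rfl ?_ ?_
    · rw [(hx k).1]; exact hk
    · rw [(hx k).1]; exact ha

end SimpleGraph

/-! ### Rays traced by injective sequences of vertices. -/

section PathCoord

variable {V : Type*}

/-- The piecewise linear path through a sequence of vertices without repetition, as a function to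
`V → ℝ`. -/
noncomputable def pathCoord (x : ℕ → V) (t : ℝ≥0) : V → ℝ :=
  -- The coordinate at `x k` is a tent of height one centred at time `k`; the default `0` serves the
  -- vertices off the path.
  Function.extend x (fun k => max 0 (1 - |(t : ℝ) - k|)) 0

theorem continuous_pathCoord {x : ℕ → V} (hx : Function.Injective x) :
    Continuous (pathCoord x) := by
  refine continuous_pi fun v => ?_
  by_cases hv : ∃ k, x k = v
  · obtain ⟨k, rfl⟩ := hv
    simp only [pathCoord, hx.extend_apply]
    fun_prop
  · simp only [pathCoord, Function.extend_apply' _ _ _ hv]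
    exact continuous_const

theorem exists_of_pathCoord_ne_zero {x : ℕ → V} (hx : Function.Injective x) {t : ℝ≥0} {v : V}
    (h : pathCoord x t v ≠ 0) : ∃ k : ℕ, x k = v ∧ |(t : ℝ) - k| < 1 := by
  by_cases hv : ∃ k, x k = v
  · obtain ⟨k, rfl⟩ := hv
    refine ⟨k, rfl, ?_⟩
    by_contra! hk
    apply h
    simp only [pathCoord, hx.extend_apply]
    exact max_eq_left (by linarith)
  · exact absurd (by simp only [pathCoord, Function.extend_apply' _ _ _ hv]; rfl) h

end PathCoord

/-! ### Topology of the geometric realization. -/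

section Realization

open Set Filter Topology

variable {V : Type*} [DecidableEq V] {Γ : SimpleGraph V}

/-- The point of the geometric realization at the vertex `v`. -/
def vertexPoint (Γ : SimpleGraph V) (v : V) : graphRealization Γ :=
  ⟨Pi.single v 1, v, v, Or.inl rfl, left_mem_segment _ _ _⟩

/-- The points with a nonzero coordinate in `A`: the union of the open stars of the vertices in
`A`. -/
def openStar (Γ : SimpleGraph V) (A : Set V) : Set (graphRealization Γ) :=
  {x | ∃ v ∈ A, x.1 v ≠ 0}

theorem openStar_mono {A B : Set V} (h : A ⊆ B) : openStar Γ A ⊆ openStar Γ B :=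
  fun _ ⟨v, hv, hx⟩ => ⟨v, h hv, hx⟩

theorem isOpen_openStar (A : Set V) : IsOpen (openStar Γ A) := by
  have : openStar Γ A = ⋃ v ∈ A, {x | x.1 v ≠ 0} := by
    ext x
    simp [openStar]
  rw [this]
  refine isOpen_biUnion fun v _ => ?_
  exact isOpen_ne_fun ((continuous_apply v).comp continuous_subtype_val) continuous_const

theorem vertexPoint_mem_openStar {A : Set V} {v : V} : vertexPoint Γ v ∈ openStar Γ A ↔ v ∈ A := by
  constructor
  · rintro ⟨w, hw, hne⟩
    by_cases h : w = v
    · exact h ▸ hw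
    · exact absurd (Pi.single_eq_of_ne h _) hne
  · exact fun hv => ⟨v, hv, by simp [vertexPoint]⟩

/-- A point of the realization lies on an edge whose endpoints carry its nonzero coordinates. -/
theorem exists_edge_of_mem_graphRealization (x : graphRealization Γ) :
    ∃ u v : V, (u = v ∨ Γ.Adj u v) ∧
      x.1 ∈ segment ℝ (Pi.single u (1 : ℝ)) (Pi.single v (1 : ℝ)) ∧
      ∀ w, x.1 w ≠ 0 → w = u ∨ w = v := by
  obtain ⟨u, v, huv, hx⟩ := x.2
  refine ⟨u, v, huv, hx, fun w hw => ?_⟩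
  obtain ⟨a, b, -, -, -, hab⟩ := hx
  by_contra! hne
  apply hw
  rw [← hab]
  simp [Pi.single_eq_of_ne hne.1, Pi.single_eq_of_ne hne.2]

theorem exists_coord_ne_zero (x : graphRealization Γ) : ∃ v, x.1 v ≠ 0 := by
  obtain ⟨u, v, -, a, b, ha, hb, hab, hx⟩ := x.2
  by_contra! h
  have hu := h u
  have hv := h v
  rw [← hx] at hu hv
  by_cases huv : u = v
  · subst huv
    simp at hu
    linarith
  · simp [Pi.single_eq_of_ne huv, Pi.single_eq_of_ne (Ne.symm huv)] at hu hv
    linarith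

theorem mem_openStar_of_notMem_compl {A : Set V} {x : graphRealization Γ}
    (h : x ∉ openStar Γ Aᶜ) : x ∈ openStar Γ A := by
  obtain ⟨v, hv⟩ := exists_coord_ne_zero x
  exact ⟨v, by_contra fun hA => h ⟨v, hA, hv⟩, hv⟩

theorem isCompact_edge {u v : V} (huv : u = v ∨ Γ.Adj u v) :
    IsCompact {x : graphRealization Γ | x.1 ∈ segment ℝ (Pi.single u (1 : ℝ)) (Pi.single v 1)} := by
  rw [Subtype.isCompact_iff]
  have hseg : IsCompact (segment ℝ (Pi.single u (1 : ℝ) : V → ℝ) (Pi.single v 1)) := by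
    rw [segment_eq_image]
    exact isCompact_Icc.image (by fun_prop)
  convert hseg using 1
  ext y
  constructor
  · rintro ⟨x, hx, rfl⟩
    exact hx
  · exact fun hy => ⟨⟨y, u, v, huv, hy⟩, hy, rfl⟩

/-- In a locally finite graph, the open star of a finite set is contained in a compact set. -/
theorem exists_isCompact_openStar_subset (hfin : ∀ v, (Γ.neighborSet v).Finite) {F : Set V}
    (hF : F.Finite) : ∃ K : Set (graphRealization Γ), IsCompact K ∧ openStar Γ F ⊆ K := by
  refine ⟨⋃ v ∈ F, ⋃ w ∈ insert v (Γ.neighborSet v),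
    {x | x.1 ∈ segment ℝ (Pi.single v (1 : ℝ)) (Pi.single w 1)}, ?_, ?_⟩
  · refine hF.isCompact_biUnion fun v _ => ((hfin v).insert v).isCompact_biUnion fun w hw => ?_
    exact isCompact_edge (hw.imp Eq.symm id)
  · rintro x ⟨v, hv, hx⟩
    obtain ⟨a, b, hab, hseg, hsupp⟩ := exists_edge_of_mem_graphRealization x
    simp only [mem_iUnion]
    rcases hsupp v hx with rfl | rfl
    · exact ⟨v, hv, b, hab.imp Eq.symm id, hseg⟩
    · refine ⟨v, hv, a, hab.imp id (fun h => h.symm), ?_⟩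
      rw [segment_symm] at hseg
      exact hseg

/-- Every point has a nonzero coordinate, so the open stars of single vertices form an open cover.
-/
theorem exists_finite_subset_openStar {K : Set (graphRealization Γ)} (hK : IsCompact K) :
    ∃ F : Set V, F.Finite ∧ K ⊆ openStar Γ F := by
  obtain ⟨t, ht⟩ := hK.elim_finite_subcover (fun v => openStar Γ {v})
    (fun v => isOpen_openStar _) fun x _ => by
      obtain ⟨v, hv⟩ := exists_coord_ne_zero x
      exact mem_iUnion.2 ⟨v, v, rfl, hv⟩
  refine ⟨t, t.finite_toSet, fun x hx => ?_⟩
  obtain ⟨v, hv, w, rfl, hw⟩ := mem_iUnion₂.1 (ht hx)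
  exact ⟨w, hv, hw⟩

theorem weaklyLocallyCompactSpace_graphRealization (hfin : ∀ v, (Γ.neighborSet v).Finite) :
    WeaklyLocallyCompactSpace (graphRealization Γ) := by
  refine ⟨fun x => ?_⟩
  obtain ⟨v, hv⟩ := exists_coord_ne_zero x
  obtain ⟨K, hK, hsub⟩ := exists_isCompact_openStar_subset hfin (finite_singleton v)
  exact ⟨K, hK, mem_of_superset ((isOpen_openStar {v}).mem_nhds ⟨v, rfl, hv⟩) hsub⟩

/-- A point can be joined to every vertex in its support inside the complement of any open star that
does not contain it. -/
theorem joinedIn_vertexPoint {F : Set V} {x : graphRealization Γ} (hx : x ∉ openStar Γ F) {v : V}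
    (hv : x.1 v ≠ 0) : JoinedIn (openStar Γ F)ᶜ x (vertexPoint Γ v) := by
  have hvF : v ∉ F := fun h => hx ⟨v, h, hv⟩
  obtain ⟨a, b, hab, hseg, hsupp⟩ := exists_edge_of_mem_graphRealization x
  have hvseg : (Pi.single v (1 : ℝ) : V → ℝ) ∈
      segment ℝ (Pi.single a (1 : ℝ) : V → ℝ) (Pi.single b 1) := by
    rcases hsupp v hv with rfl | rfl
    · exact left_mem_segment _ _ _
    · exact right_mem_segment _ _ _
  have hsub := (convex_segment (𝕜 := ℝ) (Pi.single a (1 : ℝ) : V → ℝ) (Pi.single b 1)).segment_subset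
    hseg hvseg
  have hpc : IsPathConnected
      {y : graphRealization Γ | y.1 ∈ segment ℝ x.1 (Pi.single v (1 : ℝ))} := by
    rw [IsInducing.subtypeVal.isPathConnected_iff]
    convert (convex_segment (𝕜 := ℝ) x.1 (Pi.single v (1 : ℝ))).isPathConnected
      ⟨_, left_mem_segment _ _ _⟩ using 1
    ext y
    constructor
    · rintro ⟨x, hx, rfl⟩
      exact hx
    · exact fun hy => ⟨⟨y, a, b, hab, hsub hy⟩, hy, rfl⟩
  refine (hpc.joinedIn x (left_mem_segment _ _ _) (vertexPoint Γ v)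
    (right_mem_segment _ _ _)).mono ?_
  rintro y ⟨s, t, -, -, -, hy⟩ ⟨w, hw, hne⟩
  have hxw : x.1 w = 0 := by_contra fun h => hx ⟨w, hw, h⟩
  have hwv : w ≠ v := by
    rintro rfl
    exact hvF hw
  apply hne
  rw [← hy]
  simp [hxw, Pi.single_eq_of_ne hwv]

/-- The midpoint of the edge has both endpoints in its support, so it can be joined to each of them.
-/
theorem joinedIn_vertexPoint_of_adj {F : Set V} {u v : V} (h : Γ.Adj u v) (hu : u ∉ F)
    (hv : v ∉ F) : JoinedIn (openStar Γ F)ᶜ (vertexPoint Γ u) (vertexPoint Γ v) := by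
  let m : graphRealization Γ := ⟨(1 / 2 : ℝ) • Pi.single u (1 : ℝ) + (1 / 2 : ℝ) • Pi.single v 1,
    u, v, Or.inr h, 1 / 2, 1 / 2, by norm_num, by norm_num, by norm_num, rfl⟩
  have hm : m ∉ openStar Γ F := by
    rintro ⟨w, hw, hne⟩
    apply hne
    have h1 : w ≠ u := by rintro rfl; exact hu hw
    have h2 : w ≠ v := by rintro rfl; exact hv hw
    simp [m, Pi.single_eq_of_ne h1, Pi.single_eq_of_ne h2]
  have hmu : m.1 u ≠ 0 := by simp [m, Pi.single_eq_of_ne h.ne]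
  have hmv : m.1 v ≠ 0 := by simp [m, Pi.single_eq_of_ne h.ne']
  exact (joinedIn_vertexPoint hm hmu).symm.trans (joinedIn_vertexPoint hm hmv)

/-- Between times `k` and `k + 1` only the tents at `k` and `k + 1` contribute, and their values add
up to one. -/
theorem pathCoord_mem {x : ℕ → V} (hx : Function.Injective x)
    (hadj : ∀ k, Γ.Adj (x k) (x (k + 1))) (t : ℝ≥0) : pathCoord x t ∈ graphRealization Γ := by
  obtain ⟨k, hk1, hk2⟩ : ∃ k : ℕ, (k : ℝ) ≤ t ∧ (t : ℝ) < k + 1 :=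
    ⟨⌊(t : ℝ)⌋₊, Nat.floor_le t.2, Nat.lt_floor_add_one _⟩
  refine ⟨x k, x (k + 1), Or.inr (hadj k), 1 - (t - k), t - k, by linarith, by linarith,
    by ring, ?_⟩
  ext v
  by_cases hv : ∃ j, x j = v
  · obtain ⟨j, rfl⟩ := hv
    simp only [pathCoord, hx.extend_apply, Pi.add_apply, Pi.smul_apply, smul_eq_mul,
      Pi.single_apply, hx.eq_iff]
    rcases lt_trichotomy j k with hj | rfl | hj
    · have : (j : ℝ) + 1 ≤ k := by exact_mod_cast hj
      rw [if_neg (by omega), if_neg (by omega), abs_of_nonneg (by linarith),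
        max_eq_left (by linarith)]
      ring
    · rw [if_pos rfl, if_neg (by omega), abs_of_nonneg (by linarith), max_eq_right (by linarith)]
      ring
    · rw [if_neg (by omega)]
      by_cases hj' : j = k + 1
      · subst hj'
        push_cast
        rw [if_pos rfl, abs_of_nonpos (by linarith), max_eq_right (by linarith)]
        ring
      · have : (k : ℝ) + 2 ≤ j := by exact_mod_cast (show k + 2 ≤ j by omega)
        rw [if_neg hj', abs_of_nonpos (by linarith), max_eq_left (by linarith)]
        ring
  · have h1 : v ≠ x k := fun h => hv ⟨k, h.symm⟩
    have h2 : v ≠ x (k + 1) := fun h => hv ⟨k + 1, h.symm⟩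
    simp [pathCoord, Function.extend_apply' _ _ _ hv, Pi.single_eq_of_ne h1,
      Pi.single_eq_of_ne h2]

/-- A compact set meets the open stars of finitely many vertices only. By injectivity their indices
are at most some `N`, so the ray has left the compact set by time `N + 1`. -/
theorem isProperMap_pathCoord (hfin : ∀ v, (Γ.neighborSet v).Finite) {x : ℕ → V}
    (hx : Function.Injective x) (hadj : ∀ k, Γ.Adj (x k) (x (k + 1))) :
    IsProperMap fun t => (⟨pathCoord x t, pathCoord_mem hx hadj t⟩ : graphRealization Γ) := by
  have := weaklyLocallyCompactSpace_graphRealization hfin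
  have hcont : Continuous fun t => (⟨pathCoord x t, pathCoord_mem hx hadj t⟩ :
      graphRealization Γ) := (continuous_pathCoord hx).subtype_mk _
  rw [isProperMap_iff_isCompact_preimage]
  refine ⟨hcont, fun K hK => ?_⟩
  obtain ⟨F, hF, hKF⟩ := exists_finite_subset_openStar hK
  obtain ⟨N, hN⟩ := (hF.preimage hx.injOn).bddAbove
  refine (isCompact_Icc (a := (0 : ℝ≥0)) (b := N + 1)).of_isClosed_subset
    (hK.isClosed.preimage hcont) fun t ht => ⟨zero_le, ?_⟩
  obtain ⟨v, hv, hne⟩ := hKF ht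
  obtain ⟨k, rfl, hk⟩ := exists_of_pathCoord_ne_zero hx hne
  have hkN : (k : ℝ) ≤ N := by exact_mod_cast hN hv
  rw [← NNReal.coe_le_coe]
  push_cast
  linarith [(abs_lt.1 hk).2]

end Realization

/-! ### Ends and vertex sets with finite boundary. -/

section RaysAndSides

open Set Filter Topology

variable {V : Type*} [DecidableEq V] {Γ : SimpleGraph V}

/-- The support of a point lies in the endpoints of one edge; if it meets both sides, that edge
crosses from `A` to `Aᶜ`. -/
theorem openStar_inter_openStar_compl_subset (A : Set V) :
    openStar Γ A ∩ openStar Γ Aᶜ ⊆ openStar Γ (Γ.vertexBoundary A) := by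
  rintro x ⟨⟨a, ha, hxa⟩, b, hb, hxb⟩
  obtain ⟨u, v, huv, -, hsupp⟩ := exists_edge_of_mem_graphRealization x
  have hne : a ≠ b := by
    rintro rfl
    exact hb ha
  have hadj : Γ.Adj a b := by
    rcases hsupp a hxa with rfl | rfl <;> rcases hsupp b hxb with rfl | rfl
    · exact absurd rfl hne
    · exact huv.resolve_left hne
    · exact (huv.resolve_left hne.symm).symm
    · exact absurd rfl hne
  exact ⟨a, ⟨b, hadj, fun h => hb (h.1 ha)⟩, hxa⟩

/-- A connected set that avoids the open star of the boundary of `A` lies on one side of `A`. -/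
theorem IsPreconnected.forall_notMem_openStar {A : Set V} {s : Set (graphRealization Γ)}
    (hs : IsPreconnected s) (hd : Disjoint s (openStar Γ (Γ.vertexBoundary A))) :
    (∀ x ∈ s, x ∉ openStar Γ Aᶜ) ∨ ∀ x ∈ s, x ∉ openStar Γ A := by
  by_contra! h
  obtain ⟨⟨x, hx, hxA⟩, y, hy, hyA⟩ := h
  obtain ⟨z, hz, hz'⟩ := hs _ _ (isOpen_openStar A) (isOpen_openStar Aᶜ)
    (fun w _ => or_iff_not_imp_right.2 mem_openStar_of_notMem_compl) ⟨y, hy, hyA⟩ ⟨x, hx, hxA⟩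
  exact disjoint_left.1 hd hz (openStar_inter_openStar_compl_subset A hz')

/-- The ray `r` eventually runs in the side `A` of the graph. -/
def TendsInto (r : ProperRay (graphRealization Γ)) (A : Set V) : Prop :=
  ∀ᶠ t in atTop, r.1 t ∉ openStar Γ Aᶜ

theorem ProperRay.eventually_notMem {X : Type*} [TopologicalSpace X] (r : ProperRay X) {K : Set X}
    (hK : IsCompact K) : ∀ᶠ t in atTop, r.1 t ∉ K := by
  obtain ⟨b, hb⟩ := (r.2.isCompact_preimage hK).bddAbove
  filter_upwards [eventually_gt_atTop b] with t ht hmem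
  exact absurd (hb hmem) (not_le.2 ht)

theorem ProperRay.eventually_notMem_openStar (hfin : ∀ v, (Γ.neighborSet v).Finite)
    (r : ProperRay (graphRealization Γ)) {F : Set V} (hF : F.Finite) :
    ∀ᶠ t in atTop, r.1 t ∉ openStar Γ F := by
  obtain ⟨K, hK, hsub⟩ := exists_isCompact_openStar_subset (Γ := Γ) hfin hF
  filter_upwards [r.eventually_notMem hK] with t ht h
  exact ht (hsub h)

/-- By properness a tail of the ray avoids the open star of the finite boundary, and a tail is
connected. -/
theorem ProperRay.tendsInto_or_tendsInto_compl (hfin : ∀ v, (Γ.neighborSet v).Finite)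
    (r : ProperRay (graphRealization Γ)) {A : Set V} (hA : (Γ.vertexBoundary A).Finite) :
    TendsInto r A ∨ TendsInto r Aᶜ := by
  obtain ⟨N, hN⟩ := eventually_atTop.1 (r.eventually_notMem_openStar hfin hA)
  have hs : IsPreconnected (r.1 '' Ici N) := isPreconnected_Ici.image _ r.2.continuous.continuousOn
  have hd : Disjoint (r.1 '' Ici N) (openStar Γ (Γ.vertexBoundary A)) := by
    rw [disjoint_left]
    rintro _ ⟨t, ht, rfl⟩
    exact hN t ht
  refine (hs.forall_notMem_openStar hd).imp (fun h => ?_) (fun h => ?_)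
  · exact eventually_atTop.2 ⟨N, fun t ht => h _ ⟨t, ht, rfl⟩⟩
  · rw [TendsInto, compl_compl]
    exact eventually_atTop.2 ⟨N, fun t ht => h _ ⟨t, ht, rfl⟩⟩

theorem TendsInto.not_disjoint {r : ProperRay (graphRealization Γ)} {A B : Set V}
    (hA : TendsInto r A) (hB : TendsInto r B) : ¬Disjoint A B := by
  intro hd
  obtain ⟨t, h1, h2⟩ := (hA.and hB).exists
  obtain ⟨v, hv⟩ := exists_coord_ne_zero (r.1 t)
  by_cases hvA : v ∈ A
  · exact h2 ⟨v, disjoint_left.1 hd hvA, hv⟩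
  · exact h1 ⟨v, hvA, hv⟩

theorem TendsInto.infinite (hfin : ∀ v, (Γ.neighborSet v).Finite)
    {r : ProperRay (graphRealization Γ)} {A : Set V} (hA : TendsInto r A) : A.Infinite := by
  intro hF
  obtain ⟨t, h1, h2⟩ := (hA.and (r.eventually_notMem_openStar hfin hF)).exists
  exact h2 (mem_openStar_of_notMem_compl h1)

/-- Rays that define the same end run on the same side of every set with finite boundary. -/
theorem SameEnd.tendsInto (hfin : ∀ v, (Γ.neighborSet v).Finite)
    {r r' : ProperRay (graphRealization Γ)} (h : SameEnd r r') {A : Set V}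
    (hA : (Γ.vertexBoundary A).Finite) (hr : TendsInto r A) : TendsInto r' A := by
  obtain ⟨K, hK, hsub⟩ := exists_isCompact_openStar_subset (Γ := Γ) hfin hA
  obtain ⟨N, p, hp, h1, h2⟩ := h K hK
  have hs : IsPreconnected (pathComponentIn Kᶜ p) :=
    (isPathConnected_pathComponentIn hp).isConnected.isPreconnected
  have hd : Disjoint (pathComponentIn Kᶜ p) (openStar Γ (Γ.vertexBoundary A)) :=
    disjoint_left.2 fun x hx hx' => pathComponentIn_subset hx (hsub hx')
  rcases hs.forall_notMem_openStar hd with hside | hside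
  · exact eventually_atTop.2 ⟨N, fun t ht => hside _ (h2 ⟨t, ht, rfl⟩)⟩
  · obtain ⟨t, ht, ht'⟩ := (hr.and (eventually_ge_atTop (N : ℝ≥0))).exists
    exact absurd (mem_openStar_of_notMem_compl ht) (hside _ (h1 ⟨t, ht', rfl⟩))

/-- In a connected locally finite graph, a ray runs into every infinite set of vertices with finite
boundary. -/
theorem exists_ray_tendsInto (hΓ : Γ.Connected) (hfin : ∀ v, (Γ.neighborSet v).Finite) {A : Set V}
    (hA : A.Infinite) (hb : (Γ.vertexBoundary A).Finite) :
    ∃ r : ProperRay (graphRealization Γ), TendsInto r A := by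
  obtain ⟨x, hadj, hx, N, hN⟩ := hΓ.exists_path_eventually_mem hfin hA hb
  refine ⟨⟨_, isProperMap_pathCoord hfin hx hadj⟩, ?_⟩
  filter_upwards [eventually_ge_atTop ((N : ℝ≥0) + 1)] with t ht
  rintro ⟨v, hv, hne⟩
  obtain ⟨k, rfl, hk⟩ := exists_of_pathCoord_ne_zero hx hne
  refine hv (hN k ?_)
  have ht' : (N : ℝ) + 1 ≤ t := by exact_mod_cast ht
  have : (N : ℝ) < k := by linarith [(abs_lt.1 hk).2]
  exact_mod_cast this.le

/-- Rays that define different ends are separated by a set of vertices with finite boundary. -/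
theorem exists_separating_set (hfin : ∀ v, (Γ.neighborSet v).Finite)
    {r r' : ProperRay (graphRealization Γ)} (h : ¬SameEnd r r') :
    ∃ A : Set V, (Γ.vertexBoundary A).Finite ∧ TendsInto r A ∧ TendsInto r' Aᶜ := by
  simp only [SameEnd, not_forall] at h
  obtain ⟨K, hK, hne⟩ := h
  obtain ⟨N, p, hp, hr, -⟩ := SameEnd.refl r K hK
  obtain ⟨N', p', hp', hr', -⟩ := SameEnd.refl r' K hK
  have hpp : ¬JoinedIn Kᶜ p p' := by
    intro hj
    refine hne ⟨max N N', p, hp, ?_, ?_⟩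
    · refine (image_mono (Ici_subset_Ici.2 ?_)).trans hr
      exact_mod_cast le_max_left N N'
    · rintro _ ⟨t, ht, rfl⟩
      have hN' : (N' : ℝ≥0) ≤ (max N N' : ℕ) := by exact_mod_cast le_max_right N N'
      exact hj.trans (hr' ⟨t, hN'.trans ht, rfl⟩)
  obtain ⟨F, hF, hKF⟩ := exists_finite_subset_openStar hK
  have hmono : (openStar Γ F)ᶜ ⊆ Kᶜ := compl_subset_compl.2 hKF
  -- The separating set is the set of vertices in the path component of `Kᶜ` that holds the tail of
  -- `r`. Its boundary vertices lie in `F` or next to `F`, since any other edge avoids `K`.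
  refine ⟨{v | JoinedIn Kᶜ p (vertexPoint Γ v)}, ?_, ?_, ?_⟩
  · refine (hF.union (hF.biUnion fun v _ => hfin v)).subset ?_
    rintro u ⟨v, hadj, huv⟩
    by_contra hu
    rw [mem_union, not_or] at hu
    have hv : v ∉ F := fun hv => hu.2 (mem_biUnion hv hadj.symm)
    have hj := (joinedIn_vertexPoint_of_adj hadj hu.1 hv).mono hmono
    exact huv ⟨fun h => h.trans hj, fun h => h.trans hj.symm⟩
  · filter_upwards [r.eventually_notMem_openStar hfin hF, eventually_ge_atTop (N : ℝ≥0)]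
    rintro t ht htN ⟨v, hv, hne⟩
    have hj : JoinedIn Kᶜ p (r.1 t) := hr ⟨t, htN, rfl⟩
    exact hv (hj.trans ((joinedIn_vertexPoint ht hne).mono hmono))
  · filter_upwards [r'.eventually_notMem_openStar hfin hF, eventually_ge_atTop (N' : ℝ≥0)]
    rintro t ht htN ⟨v, hv, hne⟩
    rw [compl_compl] at hv
    have hj : JoinedIn Kᶜ p' (r'.1 t) := hr' ⟨t, htN, rfl⟩
    have hv' : JoinedIn Kᶜ p (vertexPoint Γ v) := hv
    exact hpp (hv'.trans (hj.trans ((joinedIn_vertexPoint ht hne).mono hmono)).symm)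

/-- If vertices of `A` far out can be joined far out, all rays that run into `A` define the same
end. -/
theorem sameEnd_of_tendsInto (hfin : ∀ v, (Γ.neighborSet v).Finite) {A : Set V}
    (hA : ∀ F : Set V, F.Finite → ∃ F' : Set V, F'.Finite ∧ ∀ x ∈ A \ F', ∀ y ∈ A \ F',
      JoinedIn (openStar Γ F)ᶜ (vertexPoint Γ x) (vertexPoint Γ y))
    {r r' : ProperRay (graphRealization Γ)} (hr : TendsInto r A) (hr' : TendsInto r' A) :
    SameEnd r r' := by
  intro K hK
  obtain ⟨F, hF, hKF⟩ := exists_finite_subset_openStar hK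
  have hmono : (openStar Γ F)ᶜ ⊆ Kᶜ := compl_subset_compl.2 hKF
  obtain ⟨F', hF', hjoin⟩ := hA F hF
  have key : ∀ s : ProperRay (graphRealization Γ), TendsInto s A → ∀ᶠ t in atTop,
      ∃ v ∈ A \ F', JoinedIn Kᶜ (s.1 t) (vertexPoint Γ v) := by
    intro s hs
    filter_upwards [hs, s.eventually_notMem_openStar hfin (hF.union hF')] with t h1 h2
    obtain ⟨v, hv⟩ := exists_coord_ne_zero (s.1 t)
    refine ⟨v, ⟨by_contra fun h => h1 ⟨v, h, hv⟩, fun h => h2 ⟨v, Or.inr h, hv⟩⟩, ?_⟩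
    exact (joinedIn_vertexPoint (fun h => h2 (openStar_mono subset_union_left h)) hv).mono hmono
  obtain ⟨b, hb⟩ := eventually_atTop.1 ((key r hr).and (key r' hr'))
  obtain ⟨N, hN⟩ := exists_nat_ge b
  obtain ⟨v, hv, hj⟩ := (hb N hN).1
  refine ⟨N, vertexPoint Γ v, hj.target_mem, ?_, ?_⟩
  · rintro _ ⟨t, ht, rfl⟩
    obtain ⟨w, hw, hjw⟩ := (hb t (hN.trans ht)).1
    exact ((hjoin v hv w hw).mono hmono).trans hjw.symm
  · rintro _ ⟨t, ht, rfl⟩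
    obtain ⟨w, hw, hjw⟩ := (hb t (hN.trans ht)).2
    exact ((hjoin v hv w hw).mono hmono).trans hjw.symm

/-- A separating set both of whose sides are one-ended shows that there are two ends. -/
theorem card_spaceEnds_eq_two (hΓ : Γ.Connected) (hfin : ∀ v, (Γ.neighborSet v).Finite) {A : Set V}
    (hA : A.Infinite) (hA' : Aᶜ.Infinite) (hb : (Γ.vertexBoundary A).Finite)
    (h : ∀ F : Set V, F.Finite → ∃ F' : Set V, F'.Finite ∧ ∀ x ∈ A \ F', ∀ y ∈ A \ F',
      JoinedIn (openStar Γ F)ᶜ (vertexPoint Γ x) (vertexPoint Γ y))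
    (h' : ∀ F : Set V, F.Finite → ∃ F' : Set V, F'.Finite ∧ ∀ x ∈ Aᶜ \ F', ∀ y ∈ Aᶜ \ F',
      JoinedIn (openStar Γ F)ᶜ (vertexPoint Γ x) (vertexPoint Γ y)) :
    Nat.card (SpaceEnds (graphRealization Γ)) = 2 := by
  obtain ⟨r, hr⟩ := exists_ray_tendsInto hΓ hfin hA hb
  obtain ⟨r', hr'⟩ := exists_ray_tendsInto hΓ hfin hA' (Γ.vertexBoundary_compl A ▸ hb)
  refine Nat.card_eq_two_iff.2 ⟨Quotient.mk _ r, Quotient.mk _ r', fun heq => ?_, ?_⟩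
  · exact ((Quotient.exact heq : SameEnd r r').tendsInto hfin hb hr).not_disjoint hr'
      disjoint_compl_right
  · refine eq_univ_of_forall fun e => ?_
    induction e using Quotient.inductionOn with
    | h s =>
      rcases s.tendsInto_or_tendsInto_compl hfin hb with hs | hs
      · exact Or.inl (Quotient.sound (sameEnd_of_tendsInto hfin h hs hr))
      · exact Or.inr (Quotient.sound (sameEnd_of_tendsInto hfin h' hs hr'))

/-- In a two-ended graph, of three disjoint sets with finite boundary at least one is finite. -/
theorem finite_of_card_spaceEnds_eq_two (hΓ : Γ.Connected)
    (hfin : ∀ v, (Γ.neighborSet v).Finite)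
    (hcard : Nat.card (SpaceEnds (graphRealization Γ)) = 2) {A B C : Set V}
    (hA : (Γ.vertexBoundary A).Finite) (hB : (Γ.vertexBoundary B).Finite)
    (hC : (Γ.vertexBoundary C).Finite) (hAB : Disjoint A B) (hAC : Disjoint A C)
    (hBC : Disjoint B C) : A.Finite ∨ B.Finite ∨ C.Finite := by
  by_contra! h
  obtain ⟨a, ha⟩ := exists_ray_tendsInto hΓ hfin h.1 hA
  obtain ⟨b, hb⟩ := exists_ray_tendsInto hΓ hfin h.2.1 hB
  obtain ⟨c, hc⟩ := exists_ray_tendsInto hΓ hfin h.2.2 hC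
  have hne : ∀ {P Q : Set V} {p q : ProperRay (graphRealization Γ)},
      (Γ.vertexBoundary P).Finite → TendsInto p P → TendsInto q Q → Disjoint P Q →
      (Quotient.mk _ p : SpaceEnds (graphRealization Γ)) ≠ Quotient.mk _ q :=
    fun hP hp hq hd heq =>
      ((Quotient.exact heq : SameEnd _ _).tendsInto hfin hP hp).not_disjoint hq hd
  have hab := hne hA ha hb hAB
  have hac := hne hA ha hc hAC
  have hbc := hne hB hb hc hBC
  obtain ⟨x, y, -, hxy⟩ := Nat.card_eq_two_iff.1 hcard
  have hmem : ∀ e : SpaceEnds (graphRealization Γ), e = x ∨ e = y := fun e => by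
    have : e ∈ ({x, y} : Set (SpaceEnds (graphRealization Γ))) := hxy ▸ mem_univ e
    exact this
  rcases hmem (Quotient.mk _ a) with h1 | h1 <;> rcases hmem (Quotient.mk _ b) with h2 | h2 <;>
    rcases hmem (Quotient.mk _ c) with h3 | h3
  all_goals first
    | exact hab (h1.trans h2.symm)
    | exact hac (h1.trans h3.symm)
    | exact hbc (h2.trans h3.symm)

/-- In a two-ended graph, there is a set with finite boundary that is infinite and co-infinite. -/
theorem exists_separating_set_of_card_spaceEnds_eq_two (hfin : ∀ v, (Γ.neighborSet v).Finite)
    (hcard : Nat.card (SpaceEnds (graphRealization Γ)) = 2) :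
    ∃ A : Set V, (Γ.vertexBoundary A).Finite ∧ A.Infinite ∧ Aᶜ.Infinite := by
  obtain ⟨x, y, hxy, -⟩ := Nat.card_eq_two_iff.1 hcard
  induction x using Quotient.inductionOn with
  | h r =>
    induction y using Quotient.inductionOn with
    | h r' =>
      obtain ⟨A, hA, hr, hr'⟩ := exists_separating_set hfin
        (fun h : SameEnd r r' => hxy (Quotient.sound h))
      exact ⟨A, hA, hr.infinite hfin, hr'.infinite hfin⟩

/-- In a two-ended graph, two infinite co-infinite sets with finite boundary agree up to a finite
set and up to complementation. -/
theorem finite_symmDiff_of_card_spaceEnds_eq_two (hΓ : Γ.Connected)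
    (hfin : ∀ v, (Γ.neighborSet v).Finite)
    (hcard : Nat.card (SpaceEnds (graphRealization Γ)) = 2) {A B : Set V}
    (hA : (Γ.vertexBoundary A).Finite) (hAi : A.Infinite) (hAi' : Aᶜ.Infinite)
    (hB : (Γ.vertexBoundary B).Finite) (hBi : B.Infinite) (hBi' : Bᶜ.Infinite) :
    (symmDiff A B).Finite ∨ (symmDiff A Bᶜ).Finite := by
  have hA' : (Γ.vertexBoundary Aᶜ).Finite := Γ.vertexBoundary_compl A ▸ hA
  have hB' : (Γ.vertexBoundary Bᶜ).Finite := Γ.vertexBoundary_compl B ▸ hB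
  have hI : ∀ {P Q : Set V}, (Γ.vertexBoundary P).Finite → (Γ.vertexBoundary Q).Finite →
      (Γ.vertexBoundary (P ∩ Q)).Finite := fun hP hQ =>
    (hP.union hQ).subset (SimpleGraph.vertexBoundary_inter_subset _ _)
  have dl : ∀ {P P' Q Q' : Set V}, Disjoint P P' → Disjoint (P ∩ Q) (P' ∩ Q') :=
    fun h => h.mono inter_subset_left inter_subset_left
  have dr : ∀ {P P' Q Q' : Set V}, Disjoint Q Q' → Disjoint (P ∩ Q) (P' ∩ Q') :=
    fun h => h.mono inter_subset_right inter_subset_right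
  -- Among any three of the four corners `A ∩ B`, `A ∩ Bᶜ`, `Aᶜ ∩ B`, `Aᶜ ∩ Bᶜ` one is finite, so at
  -- least two are. Two corners that fill `A`, `Aᶜ`, `B` or `Bᶜ` cannot both be finite (`e1` to
  -- `e4`), so the finite ones are opposite and form a symmetric difference.
  have t1 := finite_of_card_spaceEnds_eq_two hΓ hfin hcard (hI hA hB) (hI hA hB') (hI hA' hB)
    (dr disjoint_compl_right) (dl disjoint_compl_right) (dl disjoint_compl_right)
  have t2 := finite_of_card_spaceEnds_eq_two hΓ hfin hcard (hI hA hB) (hI hA hB') (hI hA' hB')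
    (dr disjoint_compl_right) (dl disjoint_compl_right) (dl disjoint_compl_right)
  have t3 := finite_of_card_spaceEnds_eq_two hΓ hfin hcard (hI hA hB) (hI hA' hB) (hI hA' hB')
    (dl disjoint_compl_right) (dl disjoint_compl_right) (dr disjoint_compl_right)
  have t4 := finite_of_card_spaceEnds_eq_two hΓ hfin hcard (hI hA hB') (hI hA' hB) (hI hA' hB')
    (dl disjoint_compl_right) (dl disjoint_compl_right) (dr disjoint_compl_right)
  have e1 : ¬((A ∩ B).Finite ∧ (A ∩ Bᶜ).Finite) := fun h =>
    hAi ((h.1.union h.2).subset fun x hx => by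
      rcases em (x ∈ B) with h | h
      · exact Or.inl ⟨hx, h⟩
      · exact Or.inr ⟨hx, h⟩)
  have e2 : ¬((Aᶜ ∩ B).Finite ∧ (Aᶜ ∩ Bᶜ).Finite) := fun h =>
    hAi' ((h.1.union h.2).subset fun x hx => by
      rcases em (x ∈ B) with h | h
      · exact Or.inl ⟨hx, h⟩
      · exact Or.inr ⟨hx, h⟩)
  have e3 : ¬((A ∩ B).Finite ∧ (Aᶜ ∩ B).Finite) := fun h =>
    hBi ((h.1.union h.2).subset fun x hx => by
      rcases em (x ∈ A) with h | h
      · exact Or.inl ⟨h, hx⟩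
      · exact Or.inr ⟨h, hx⟩)
  have e4 : ¬((A ∩ Bᶜ).Finite ∧ (Aᶜ ∩ Bᶜ).Finite) := fun h =>
    hBi' ((h.1.union h.2).subset fun x hx => by
      rcases em (x ∈ A) with h | h
      · exact Or.inl ⟨h, hx⟩
      · exact Or.inr ⟨h, hx⟩)
  have s1 : (A ∩ Bᶜ).Finite → (Aᶜ ∩ B).Finite → (symmDiff A B).Finite := fun h h' =>
    (h.union h').subset fun x hx => by
      rcases hx with ⟨h1, h2⟩ | ⟨h1, h2⟩
      · exact Or.inl ⟨h1, h2⟩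
      · exact Or.inr ⟨h2, h1⟩
  have s2 : (A ∩ B).Finite → (Aᶜ ∩ Bᶜ).Finite → (symmDiff A Bᶜ).Finite := fun h h' =>
    (h.union h').subset fun x hx => by
      rcases hx with ⟨h1, h2⟩ | ⟨h1, h2⟩
      · exact Or.inl ⟨h1, not_not.1 h2⟩
      · exact Or.inr ⟨h2, h1⟩
  by_cases c1 : (A ∩ B).Finite
  · have h2 : ¬(A ∩ Bᶜ).Finite := fun h => e1 ⟨c1, h⟩
    have h3 : ¬(Aᶜ ∩ B).Finite := fun h => e3 ⟨c1, h⟩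
    exact Or.inr (s2 c1 ((t4.resolve_left h2).resolve_left h3))
  · refine Or.inl (s1 ?_ ?_)
    · refine (t2.resolve_left c1).resolve_right fun c4 => ?_
      exact (t1.resolve_left c1).elim (fun h => e4 ⟨h, c4⟩) (fun h => e2 ⟨h, c4⟩)
    · refine (t3.resolve_left c1).resolve_right fun c4 => ?_
      exact (t1.resolve_left c1).elim (fun h => e4 ⟨h, c4⟩) (fun h => e2 ⟨h, c4⟩)

end RaysAndSides

/-! ### A translation of infinite order in a two-ended group. -/

section CayleyGraph

open SimpleGraph
open scoped Pointwise

variable {G : Type*} [Group G] {S : Set G}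

theorem mulCayley_neighborSet_finite (hS : S.Finite) (v : G) :
    ((mulCayley S).neighborSet v).Finite := by
  refine ((hS.union hS.inv).image (v * ·)).subset fun w hw => ?_
  obtain ⟨-, h⟩ := (mulCayley_adj S v w).1 hw
  refine ⟨v⁻¹ * w, h.imp id fun h => ?_, mul_inv_cancel_left v w⟩
  simpa using h

theorem mulCayley_connected (hS : Subgroup.closure S = ⊤) : (mulCayley S).Connected := by
  have key : ∀ g : G, ∀ x, (mulCayley S).Reachable x (x * g) := by
    intro g
    have hg : g ∈ Subgroup.closure S := hS ▸ Subgroup.mem_top g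
    induction hg using Subgroup.closure_induction with
    | mem s hs =>
      intro x
      by_cases h : x = x * s
      · rw [← h]
      · exact Adj.reachable ((mulCayley_adj S x (x * s)).2 ⟨h, Or.inl (by simpa using hs)⟩)
    | one => intro x; rw [mul_one]
    | mul a b _ _ iha ihb =>
      intro x
      rw [← mul_assoc]
      exact (iha x).trans (ihb (x * a))
    | inv a _ ih =>
      intro x
      simpa using (ih (x * a⁻¹)).symm
  refine (connected_iff _).2 ⟨fun x y => ?_, ⟨1⟩⟩
  simpa using key (x⁻¹ * y) x

/-- Left multiplication is an automorphism of the Cayley graph, whose edges are right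
multiplications. -/
theorem vertexBoundary_mulCayley_smul (g : G) (A : Set G) :
    (mulCayley S).vertexBoundary (g • A) = g • (mulCayley S).vertexBoundary A := by
  ext v
  rw [Set.mem_smul_set_iff_inv_smul_mem]
  constructor
  · rintro ⟨w, hadj, hne⟩
    refine ⟨g⁻¹ * w, ?_, ?_⟩
    · rwa [smul_eq_mul, mulCayley_adj_mul_iff_right]
    · rwa [Set.mem_smul_set_iff_inv_smul_mem, Set.mem_smul_set_iff_inv_smul_mem] at hne
  · rintro ⟨w, hadj, hne⟩
    refine ⟨g * w, ?_, ?_⟩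
    · rw [smul_eq_mul] at hadj
      rw [← mulCayley_adj_mul_iff_right (d := g⁻¹), inv_mul_cancel_left]
      exact hadj
    · rwa [Set.mem_smul_set_iff_inv_smul_mem, Set.mem_smul_set_iff_inv_smul_mem, smul_eq_mul g⁻¹ (g * w),
        inv_mul_cancel_left]

/-- A translate of `E` at finite distance from `E` whose boundary is far from that of `E` is
strictly nested with `E`. -/
theorem smul_ssubset_or_ssubset_smul (hS : Subgroup.closure S = ⊤) {E C : Set G} {h : G}
    (hE : E.Infinite) (hE' : Eᶜ.Infinite) (hC : ((mulCayley S).induce C).Preconnected)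
    (hEC : (mulCayley S).vertexBoundary E ⊆ C) (hd : Disjoint C (h • C))
    (hfin : (symmDiff E (h • E)).Finite) : h • E ⊂ E ∨ E ⊂ h • E := by
  have hpre := (mulCayley_connected hS).preconnected
  obtain ⟨e, heE, he⟩ := hpre.vertexBoundary_inter_nonempty hE.nonempty hE'.nonempty
  obtain ⟨e', heE', he'⟩ := hpre.vertexBoundary_inter_nonempty hE'.nonempty
    (by rw [compl_compl]; exact hE.nonempty)
  rw [vertexBoundary_compl] at he'
  have hBC : (mulCayley S).vertexBoundary (h • E) ⊆ h • C := by
    rw [vertexBoundary_mulCayley_smul]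
    exact Set.smul_set_mono hEC
  -- `h • C` lies on one side of `E`: translated by `h⁻¹`, this says that the connected set `C`
  -- misses the boundary of `h⁻¹ • E`.
  have hside : ∀ x ∈ h • C, (x ∈ E ↔ h * e ∈ E) := by
    rintro _ ⟨c, hc, rfl⟩
    have hd' : Disjoint C ((mulCayley S).vertexBoundary (h⁻¹ • E)) := by
      rw [vertexBoundary_mulCayley_smul, Set.disjoint_left]
      intro x hx hx'
      rw [Set.mem_smul_set_iff_inv_smul_mem, inv_inv] at hx'
      exact Set.disjoint_left.1 hd (hEC hx') (Set.smul_mem_smul_set hx)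
    have := mem_iff_mem_of_induce_preconnected hC hd' hc (hEC he)
    rwa [Set.mem_smul_set_iff_inv_smul_mem, Set.mem_smul_set_iff_inv_smul_mem, inv_inv] at this
  by_cases hs : h * e ∈ E
  · left
    have hsub : h • C ⊆ E := fun x hx => (hside x hx).2 hs
    rcases subset_or_subset_compl_of_disjoint hpre hC ⟨e, hEC he⟩ hEC hBC hd hsub with h1 | h1
    -- Here `Eᶜ ⊆ h • E`, which would put the infinite set `Eᶜ` inside the finite symmetric
    -- difference. In the other alternative `e` witnesses strictness.
    · exact absurd (hfin.subset fun x hx => Or.inr ⟨h1 (Or.inl hx), hx⟩) hE'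
    · refine ⟨fun x hx => by_contra fun hxE => h1 (Or.inl hxE) hx, fun hsub => ?_⟩
      exact h1 (Or.inr (hEC he)) (hsub heE)
  · right
    have hsub : h • C ⊆ Eᶜ := fun x hx hx' => hs ((hside x hx).1 hx')
    rcases subset_or_subset_compl_of_disjoint hpre hC ⟨e, hEC he⟩
      ((vertexBoundary_compl E).trans_subset hEC) hBC hd hsub with h1 | h1
    · rw [compl_compl] at h1
      exact ⟨fun x hx => h1 (Or.inl hx), fun hsub => heE' (hsub (h1 (Or.inr (hEC he'))))⟩
    · rw [compl_compl] at h1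
      exact absurd (hfin.subset fun x hx => Or.inl ⟨hx, h1 (Or.inl hx)⟩) hE

/-- If `g₀` and `g` both carry `E` to `Eᶜ` up to finite error, then `g₀⁻¹ * g` preserves `E` up to
finite error. So a translate of the complement of this set embeds in it, and both cannot be finite.
-/
theorem infinite_setOf_finite_symmDiff_smul [Infinite G] {E : Set G}
    (h : ∀ g : G, (symmDiff E (g • E)).Finite ∨ (symmDiff E (g • E)ᶜ).Finite) :
    {g : G | (symmDiff E (g • E)).Finite}.Infinite := by
  intro hfin
  have hinf : {g : G | (symmDiff E (g • E)).Finite}ᶜ.Infinite := hfin.infinite_compl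
  obtain ⟨g₀, hg₀⟩ := hinf.nonempty
  refine (hinf.image (f := fun g => g₀⁻¹ * g) (fun a _ b _ => mul_left_cancel)) (hfin.subset ?_)
  rintro _ ⟨g, hg, rfl⟩
  have h1 := (h g₀).resolve_left hg₀
  have h2 := (h g).resolve_left hg
  have h3 : (symmDiff (g₀ • E)ᶜ (g • E)ᶜ).Finite :=
    ((symmDiff_comm E _ ▸ h1).union h2).subset (symmDiff_triangle _ E _)
  have h4 : (g₀⁻¹ • symmDiff (g₀ • E) (g • E)).Finite := by
    rw [compl_symmDiff_compl] at h3
    exact h3.smul_set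
  rwa [Set.smul_set_symmDiff, smul_smul, inv_mul_cancel, one_smul, smul_smul] at h4

/-- In a two-ended group, some translation moves an infinite co-infinite set with finite boundary
strictly into itself, leaving a finite remainder. -/
theorem exists_smul_ssubset [DecidableEq G] (hSfin : S.Finite) (hS : Subgroup.closure S = ⊤)
    (hcard : Nat.card (SpaceEnds (graphRealization (mulCayley S))) = 2) :
    ∃ (E : Set G) (z : G), ((mulCayley S).vertexBoundary E).Finite ∧ Eᶜ.Nonempty ∧
      z • E ⊂ E ∧ (E \ z • E).Finite := by
  have hΓ := mulCayley_connected hS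
  have hloc := mulCayley_neighborSet_finite hSfin
  obtain ⟨E, hb, hE, hE'⟩ := exists_separating_set_of_card_spaceEnds_eq_two hloc hcard
  have : Infinite G := Set.infinite_univ_iff.1 (hE.mono (Set.subset_univ E))
  have hcomm : ∀ g : G, (symmDiff E (g • E)).Finite ∨ (symmDiff E (g • E)ᶜ).Finite := by
    intro g
    refine finite_symmDiff_of_card_spaceEnds_eq_two hΓ hloc hcard hb hE hE' ?_ ?_ ?_
    · rw [vertexBoundary_mulCayley_smul]
      exact hb.smul_set
    · exact hE.smul_set
    · rw [← Set.smul_set_compl]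
      exact hE'.smul_set
  obtain ⟨e, -, he⟩ := hΓ.preconnected.vertexBoundary_inter_nonempty hE.nonempty hE'.nonempty
  obtain ⟨C, hEC, hC⟩ := extend_finset_to_connected hΓ.preconnected (t := hb.toFinset)
    ⟨e, by simpa using he⟩
  -- If `C` meets `h • C`, then `h` lies in `C * C⁻¹`; so all but finitely many `h` move `C` off
  -- itself.
  have hCfin : ((C : Set G) * (C : Set G)⁻¹).Finite := C.finite_toSet.mul C.finite_toSet.inv
  obtain ⟨h, hh, hhC⟩ := ((infinite_setOf_finite_symmDiff_smul hcomm).sdiff hCfin).nonempty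
  have hd : Disjoint (C : Set G) (h • (C : Set G)) := by
    rw [Set.disjoint_left]
    rintro _ hx ⟨c, hc, rfl⟩
    exact hhC ⟨_, hx, c⁻¹, Set.inv_mem_inv.2 hc, by simp⟩
  have hfin : (symmDiff E (h • E)).Finite := hh
  rcases smul_ssubset_or_ssubset_smul hS hE hE' hC.preconnected (fun x hx => hEC (by simpa using hx))
    hd hfin with hsub | hsub
  · exact ⟨E, h, hb, hE'.nonempty, hsub, hfin.subset fun x hx => Or.inl hx⟩
  · refine ⟨E, h⁻¹, hb, hE'.nonempty, ?_, ?_⟩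
    · refine ⟨?_, fun hsub' => hsub.not_subset ?_⟩
      · simpa only [inv_smul_smul] using Set.smul_set_mono (a := h⁻¹) hsub.subset
      · simpa only [smul_inv_smul] using Set.smul_set_mono (a := h) hsub'
    · have : (h⁻¹ • (h • E \ E)).Finite := (hfin.subset fun x hx => Or.inr hx).smul_set
      rwa [Set.smul_set_sdiff, inv_smul_smul] at this

/-- All positive powers carry `E` into `z • E`, so none of them is the identity. -/
theorem not_isOfFinOrder_of_smul_ssubset {E : Set G} {z : G} (h : z • E ⊂ E) :
    ¬IsOfFinOrder z := by
  rw [isOfFinOrder_iff_pow_eq_one]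
  rintro ⟨n, hn, hz⟩
  have key : ∀ k : ℕ, z ^ (k + 1) • E ⊆ z • E := by
    intro k
    induction k with
    | zero => simp
    | succ k ih =>
      rw [pow_succ', mul_smul]
      exact Set.smul_set_mono (ih.trans h.subset)
  obtain ⟨k, rfl⟩ := Nat.exists_eq_succ_of_ne_zero hn.ne'
  have := key k
  rw [hz, one_smul] at this
  exact h.not_subset this

/-- The sets `z ^ n • E` decrease with `n`. If `n` is the last index with `x ∈ z ^ n • E`, then `z ^
(-n) * x` lies in `E` but not in `z • E`. -/
theorem exists_zpow_mul_of_smul_ssubset (hS : Subgroup.closure S = ⊤) {E : Set G} {z : G}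
    (hb : ((mulCayley S).vertexBoundary E).Finite) (hE' : Eᶜ.Nonempty) (h : z • E ⊂ E) (x : G) :
    ∃ n : ℤ, ∃ d ∈ E \ z • E, x = z ^ n * d := by
  have hinj := injective_zpow_iff_not_isOfFinOrder.2 (not_isOfFinOrder_of_smul_ssubset h)
  have hanti : Antitone fun n : ℤ => z ^ n • E := by
    refine antitone_int_of_succ_le fun n => ?_
    rw [zpow_add_one, mul_smul]
    exact Set.smul_set_mono h.subset
  -- A fixed walk from `a` to `b` must meet the boundary of each `z ^ n • E` that separates them,
  -- which happens for finitely many `n` only. Comparing `x` with a point outside `E` and a point of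
  -- `E` shows that a last index exists.
  have hcross : ∀ a b : G, {n : ℤ | ¬(a ∈ z ^ n • E ↔ b ∈ z ^ n • E)}.Finite := by
    intro a b
    obtain ⟨p⟩ := (mulCayley_connected hS).preconnected a b
    have hfin : ({v | v ∈ p.support} * ((mulCayley S).vertexBoundary E)⁻¹).Finite :=
      (List.finite_toSet p.support).mul hb.inv
    refine (hfin.preimage hinj.injOn).subset fun n hn => ?_
    obtain ⟨v, hv, hvb⟩ := p.exists_mem_support_vertexBoundary hn
    rw [vertexBoundary_mulCayley_smul] at hvb
    obtain ⟨c, hc, rfl⟩ := hvb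
    exact ⟨_, hv, c⁻¹, Set.inv_mem_inv.2 hc, by simp⟩
  obtain ⟨y, hy⟩ := hE'
  obtain ⟨y', hy'⟩ := (Set.nonempty_of_ssubset h).mono Set.sdiff_subset
  obtain ⟨m, hm0, hm⟩ := ((Set.Ici_infinite (0 : ℤ)).sdiff (hcross x y)).nonempty
  obtain ⟨k, hk0, hk⟩ := ((Set.Iic_infinite (0 : ℤ)).sdiff (hcross x y')).nonempty
  have hym : y ∉ z ^ m • E := fun hmem => hy (by simpa using hanti hm0 hmem)
  have hyk : y' ∈ z ^ k • E := hanti hk0 (by simpa using hy')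
  have hxm : x ∉ z ^ m • E := fun hx => hym ((not_not.1 hm).1 hx)
  have hxk : x ∈ z ^ k • E := (not_not.1 hk).2 hyk
  obtain ⟨n, hn, hmax⟩ := Int.exists_greatest_of_bdd (P := fun n => x ∈ z ^ n • E)
    ⟨m, fun n hn => le_of_not_ge fun hmn => hxm (hanti hmn hn)⟩ ⟨k, hxk⟩
  obtain ⟨d, hd, rfl⟩ := hn
  refine ⟨n, d, ⟨hd, fun hdz => ?_⟩, rfl⟩
  have := hmax (n + 1) (by
    rw [zpow_add_one, mul_smul]
    exact Set.smul_mem_smul_set hdz)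
  omega

end CayleyGraph

/-! ### Two ends from a coarse map to the integers. -/

section TwoEndedFromMap

open SimpleGraph
open scoped Pointwise

variable {G : Type*} [Group G] [DecidableEq G] {S : Set G}

/-- Every right translation is realized by paths in the Cayley graph through vertices at bounded
position relative to their starting point. -/
theorem exists_finite_joinedIn_mul (hS : Subgroup.closure S = ⊤) (q : G) :
    ∃ Q : Set G, Q.Finite ∧ ∀ (x : G) (F : Set G), (∀ a ∈ Q, x * a ∉ F) →
      JoinedIn (openStar (mulCayley S) F)ᶜ (vertexPoint (mulCayley S) x)
        (vertexPoint (mulCayley S) (x * q)) := by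
  have hq : q ∈ Subgroup.closure S := hS ▸ Subgroup.mem_top q
  have hrefl : ∀ (x : G) (F : Set G), x ∉ F →
      JoinedIn (openStar (mulCayley S) F)ᶜ (vertexPoint (mulCayley S) x)
        (vertexPoint (mulCayley S) x) := fun x F hx =>
    JoinedIn.refl fun h => hx (vertexPoint_mem_openStar.1 h)
  induction hq using Subgroup.closure_induction with
  | mem s hs =>
    refine ⟨{1, s}, by simp, fun x F h => ?_⟩
    have h1 : x ∉ F := by simpa using h 1 (by simp)
    by_cases hx : x = x * s
    · rw [← hx]
      exact hrefl x F h1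
    · exact joinedIn_vertexPoint_of_adj
        ((mulCayley_adj S x (x * s)).2 ⟨hx, Or.inl (by simpa using hs)⟩) h1 (h s (by simp))
  | one =>
    refine ⟨{1}, by simp, fun x F h => ?_⟩
    rw [mul_one]
    exact hrefl x F (by simpa using h 1 rfl)
  | mul a b _ _ iha ihb =>
    obtain ⟨Q, hQ, hQ'⟩ := iha
    obtain ⟨R, hR, hR'⟩ := ihb
    refine ⟨Q ∪ a • R, hQ.union hR.smul_set, fun x F h => ?_⟩
    rw [← mul_assoc]
    refine (hQ' x F fun c hc => h c (Or.inl hc)).trans (hR' (x * a) F fun c hc => ?_)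
    rw [mul_assoc]
    exact h _ (Or.inr (Set.smul_mem_smul_set hc))
  | inv a _ ih =>
    obtain ⟨Q, hQ, hQ'⟩ := ih
    refine ⟨a⁻¹ • Q, hQ.smul_set, fun x F h => ?_⟩
    have := hQ' (x * a⁻¹) F fun c hc => by
      rw [mul_assoc]
      exact h _ (Set.smul_mem_smul_set hc)
    rw [inv_mul_cancel_right] at this
    exact this.symm

theorem exists_finite_joinedIn_mul_of_finite (hS : Subgroup.closure S = ⊤) {P : Set G}
    (hP : P.Finite) :
    ∃ Q : Set G, Q.Finite ∧ ∀ q ∈ P, ∀ (x : G) (F : Set G), (∀ a ∈ Q, x * a ∉ F) →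
      JoinedIn (openStar (mulCayley S) F)ᶜ (vertexPoint (mulCayley S) x)
        (vertexPoint (mulCayley S) (x * q)) := by
  choose Q hQ hQ' using exists_finite_joinedIn_mul hS
  exact ⟨⋃ q ∈ P, Q q, hP.biUnion fun q _ => hQ q, fun q hq x F h =>
    hQ' q x F fun a ha => h a (Set.mem_biUnion hq ha)⟩

/-- Each `x` is joined to `g (f x)`, and from there along the values of `g` down to a fixed base
point. These paths make bounded displacements, so `f` stays above its maximum on `F` and they avoid
`F`. -/
theorem exists_joinedIn_of_le (hS : Subgroup.closure S = ⊤) {f : G → ℤ} {g : ℤ → G}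
    (hf : ∀ Q : Set G, Q.Finite → ∃ L : ℤ, ∀ x, ∀ q ∈ Q, |f (x * q) - f x| ≤ L)
    (hgf : ∃ Q : Set G, Q.Finite ∧ ∀ x, x⁻¹ * g (f x) ∈ Q)
    (hfg : ∃ r : ℤ, ∀ n, |f (g n) - n| ≤ r)
    (hg : ∃ Q : Set G, Q.Finite ∧ ∀ n, (g n)⁻¹ * g (n + 1) ∈ Q) {F : Set G} (hF : F.Finite) :
    ∃ M : ℤ, ∀ x y, M ≤ f x → M ≤ f y →
      JoinedIn (openStar (mulCayley S) F)ᶜ (vertexPoint (mulCayley S) x)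
        (vertexPoint (mulCayley S) y) := by
  obtain ⟨P, hP, hPmem⟩ := hgf
  obtain ⟨P', hP', hPmem'⟩ := hg
  obtain ⟨r, hr⟩ := hfg
  obtain ⟨Q, hQ, hQj⟩ := exists_finite_joinedIn_mul_of_finite hS (hP.union hP')
  obtain ⟨L, hL⟩ := hf Q hQ
  obtain ⟨m, hm⟩ := (hF.image f).bddAbove
  have hjoin : ∀ x, ∀ q ∈ P ∪ P', m + L < f x →
      JoinedIn (openStar (mulCayley S) F)ᶜ (vertexPoint (mulCayley S) x)
        (vertexPoint (mulCayley S) (x * q)) := by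
    refine fun x q hq hx => hQj q hq x F fun a ha hmem => ?_
    have h1 := (abs_le.1 (hL x a ha)).1
    have h2 := hm (Set.mem_image_of_mem f hmem)
    omega
  have hr0 : 0 ≤ r := (abs_nonneg _).trans (hr 0)
  have hstep : ∀ n, m + L + r < n →
      JoinedIn (openStar (mulCayley S) F)ᶜ (vertexPoint (mulCayley S) (g n))
        (vertexPoint (mulCayley S) (g (n + 1))) := by
    intro n hn
    have h1 := (abs_le.1 (hr n)).1
    have := hjoin (g n) _ (Or.inr (hPmem' n)) (by omega)
    rwa [mul_inv_cancel_left] at this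
  have hchain : ∀ n k, m + L + r < n → n ≤ k →
      JoinedIn (openStar (mulCayley S) F)ᶜ (vertexPoint (mulCayley S) (g n))
        (vertexPoint (mulCayley S) (g k)) := by
    intro n k hn hk
    induction k, hk using Int.leInduction with
    | base => exact JoinedIn.refl (hstep n hn).source_mem
    | succ k hk ih => exact ih.trans (hstep k (by omega))
  have hx : ∀ x, m + L + r + 1 ≤ f x →
      JoinedIn (openStar (mulCayley S) F)ᶜ (vertexPoint (mulCayley S) x)
        (vertexPoint (mulCayley S) (g (m + L + r + 1))) := by
    intro x hx
    have := hjoin x _ (Or.inl (hPmem x)) (by omega)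
    rw [mul_inv_cancel_left] at this
    exact this.trans (hchain _ _ (by omega) hx).symm
  -- `m` bounds `f` on `F`, `L` bounds the change of `f` along one connecting path, and `r` is the
  -- error in passing from `n` to `f (g n)`; the `1` makes the inequality strict.
  exact ⟨m + L + r + 1, fun x y h h' => (hx x h).trans (hx y h').symm⟩

/-- The set where `0 ≤ f` separates the two ends. Since `f` changes by a bounded amount along an
edge, its boundary lies where `|f|` is bounded, a finite set by `hproper`. -/
theorem card_spaceEnds_mulCayley_eq_two (hSfin : S.Finite) (hS : Subgroup.closure S = ⊤)
    {f : G → ℤ} {g : ℤ → G}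
    (hf : ∀ Q : Set G, Q.Finite → ∃ L : ℤ, ∀ x, ∀ q ∈ Q, |f (x * q) - f x| ≤ L)
    (hproper : ∀ M : ℤ, {x | |f x| ≤ M}.Finite)
    (hgf : ∃ Q : Set G, Q.Finite ∧ ∀ x, x⁻¹ * g (f x) ∈ Q)
    (hfg : ∃ r : ℤ, ∀ n, |f (g n) - n| ≤ r)
    (hg : ∃ Q : Set G, Q.Finite ∧ ∀ n, (g n)⁻¹ * g (n + 1) ∈ Q) :
    Nat.card (SpaceEnds (graphRealization (mulCayley S))) = 2 := by
  have hgf' := hgf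
  have hfg' := hfg
  have hg' := hg
  obtain ⟨r, hr⟩ := hfg
  -- The image of `f` is `r`-dense. Thickening `[r, ∞)` and `(-∞, -r)` by `r` keeps the sign, so
  -- both sides are infinite.
  have hinf : ∀ (T : Set ℤ), T.Infinite → (f ⁻¹' (T + Set.Icc (-r) r)).Infinite := by
    intro T hT hfin
    have h1 := ((hfin.image f).add (Set.finite_Icc (-r) r))
    refine hT (h1.subset fun n hn => ?_)
    obtain ⟨h2, h3⟩ := abs_le.1 (hr n)
    refine ⟨f (g n), ⟨g n, ?_, rfl⟩, n - f (g n), ⟨by omega, by omega⟩, by simp⟩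
    exact ⟨n, hn, f (g n) - n, ⟨by omega, by omega⟩, by simp⟩
  refine card_spaceEnds_eq_two (A := {x | 0 ≤ f x}) (mulCayley_connected hS)
    (mulCayley_neighborSet_finite hSfin) ?_ ?_ ?_ ?_ ?_
  · refine (hinf (Set.Ici r) (Set.Ici_infinite r)).mono ?_
    rintro x ⟨a, ha, b, hb, hab⟩
    have h1 : r ≤ a := ha
    have h2 : -r ≤ b := hb.1
    have h3 : a + b = f x := hab
    show 0 ≤ f x
    omega
  · refine (hinf (Set.Iio (-r)) (Set.Iio_infinite (-r))).mono ?_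
    rintro x ⟨a, ha, b, hb, hab⟩
    have h1 : a < -r := ha
    have h2 : b ≤ r := hb.2
    have h3 : a + b = f x := hab
    show ¬0 ≤ f x
    omega
  · obtain ⟨L, hL⟩ := hf _ (hSfin.union hSfin.inv)
    refine (hproper L).subset ?_
    rintro x ⟨y, hadj, hne⟩
    obtain ⟨-, h⟩ := (mulCayley_adj S x y).1 hadj
    have := hL x (x⁻¹ * y) (h.imp id fun h => by simpa using h)
    rw [mul_inv_cancel_left, abs_le] at this
    have hne' : ¬(0 ≤ f x ↔ 0 ≤ f y) := hne
    show |f x| ≤ L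
    rw [abs_le]
    omega
  · intro F hF
    obtain ⟨M, hM⟩ := exists_joinedIn_of_le hS hf hgf' hfg' hg' hF
    refine ⟨_, hproper M, ?_⟩
    rintro x ⟨hx, hxM⟩ y ⟨hy, hyM⟩
    have hx0 : 0 ≤ f x := hx
    have hy0 : 0 ≤ f y := hy
    have h1 : ¬|f x| ≤ M := hxM
    have h2 : ¬|f y| ≤ M := hyM
    rw [abs_of_nonneg hx0] at h1
    rw [abs_of_nonneg hy0] at h2
    exact hM x y (by omega) (by omega)
  · intro F hF
    -- Reflecting `ℤ` turns the negative side into the positive one; the steps of the reflected `g`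
    -- are inverses of steps of `g`, whence `Q⁻¹`.
    obtain ⟨M, hM⟩ := exists_joinedIn_of_le (f := fun x => -f x) (g := fun n => g (-n)) hS
      (fun Q hQ => by
        obtain ⟨L, hL⟩ := hf Q hQ
        refine ⟨L, fun x q hq => ?_⟩
        rw [← abs_neg]
        convert hL x q hq using 2
        ring)
      (by simpa only [neg_neg] using hgf')
      ⟨r, fun n => by
        rw [← abs_neg]
        convert hr (-n) using 2
        ring⟩
      (by
        obtain ⟨Q, hQ, hQ'⟩ := hg'
        refine ⟨Q⁻¹, hQ.inv, fun n => ?_⟩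
        have := hQ' (-(n + 1))
        rw [Set.mem_inv, mul_inv_rev, inv_inv]
        convert this using 3
        ring) hF
    refine ⟨_, hproper M, ?_⟩
    rintro x ⟨hx, hxM⟩ y ⟨hy, hyM⟩
    have hx0 : ¬0 ≤ f x := hx
    have hy0 : ¬0 ≤ f y := hy
    have h1 : ¬|f x| ≤ M := hxM
    have h2 : ¬|f y| ≤ M := hyM
    rw [abs_of_neg (by omega)] at h1
    rw [abs_of_neg (by omega)] at h2
    exact hM x y (by omega) (by omega)

end TwoEndedFromMap

/-! ### Finite balls and coarse control at integer scales. -/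

section WordMetricFacts

variable {G : Type*} [Group G] {T : Set G} {hT : Subgroup.closure T = ⊤}

theorem finite_setOf_wordLength_le (hTfin : T.Finite) (hT : Subgroup.closure T = ⊤) (n : ℕ) :
    {g : G | wordLength T g ≤ n}.Finite := by
  have : Finite ↥(T ∪ T⁻¹) := hTfin.union hTfin.inv
  refine ((List.finite_length_le (↥(T ∪ T⁻¹)) n).image
    fun l => (l.map Subtype.val).prod).subset fun g hg => ?_
  obtain ⟨l, ⟨hl, hprod⟩, hlen⟩ := exists_isWordFor hT g
  lift l to List ↥(T ∪ T⁻¹) using fun x hx => hl x hx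
  refine ⟨l, ?_, hprod⟩
  rw [List.length_map] at hlen
  exact hlen.trans_le hg

theorem WordMetricSpace.dist_le_natCast_iff (x y : G) (n : ℕ) :
    dist (α := WordMetricSpace T hT) x y ≤ n ↔ wordLength T (x⁻¹ * y) ≤ n :=
  Nat.cast_le

theorem WordMetricSpace.isBounded_iff_finite (hTfin : T.Finite)
    {B : Set (WordMetricSpace T hT)} : Bornology.IsBounded B ↔ B.Finite := by
  refine ⟨fun hB => ?_, Set.Finite.isBounded⟩
  obtain ⟨r, hr⟩ := (Metric.isBounded_iff_subset_closedBall
    (α := WordMetricSpace T hT) (1 : G)).1 hB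
  obtain ⟨n, hn⟩ := exists_nat_ge r
  refine (finite_setOf_wordLength_le hTfin hT n).subset fun x hx => ?_
  have h1 := (WordMetricSpace.dist_le_natCast_iff (1 : G) x n).1
    ((dist_comm (α := WordMetricSpace T hT) _ _).trans_le ((hr hx).trans hn))
  rwa [inv_one, one_mul] at h1

theorem Int.isBounded_iff_finite {B : Set ℤ} : Bornology.IsBounded B ↔ B.Finite := by
  refine ⟨fun hB => ?_, Set.Finite.isBounded⟩
  obtain ⟨r, hr⟩ := (Metric.isBounded_iff_subset_closedBall 0).1 hB
  rw [Int.closedBall_eq_Icc] at hr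
  exact (Set.finite_Icc _ _).subset hr

theorem uniformlyExpansive_of_forall_nat {X Y : Type*} [MetricSpace X] [MetricSpace Y] {f : X → Y}
    (h : ∀ n : ℕ, ∃ M : ℕ, ∀ x y, dist x y ≤ n → dist (f x) (f y) ≤ M) :
    UniformlyExpansive f := by
  choose M hM using h
  -- The bounds `M` need not be monotone, but their partial sums are, and the sum up to `⌈d⌉₊`
  -- includes the required term.
  refine ⟨fun d => ∑ i ∈ Finset.range (⌈d⌉₊ + 1), (M i : ℝ≥0), fun a b hab => ?_, fun x y => ?_⟩
  · refine Finset.sum_le_sum_of_subset (Finset.range_mono ?_)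
    exact Nat.succ_le_succ (Nat.ceil_mono hab)
  · have h1 : nndist (f x) (f y) ≤ (M ⌈nndist x y⌉₊ : ℝ≥0) := by
      have := hM ⌈nndist x y⌉₊ x y (by
        rw [← coe_nndist]
        exact_mod_cast Nat.le_ceil (nndist x y))
      rw [← coe_nndist] at this
      exact_mod_cast this
    exact h1.trans (Finset.single_le_sum (f := fun i => (M i : ℝ≥0)) (fun _ _ => zero_le)
      (Finset.mem_range.2 (Nat.lt_succ_self _)))

end WordMetricFacts

/-! ### Coarse equivalence with the integers. -/

section CoarseEquivalenceWithInt

open scoped Pointwise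

variable {G : Type*} [Group G] {T : Set G} {hT : Subgroup.closure T = ⊤}

theorem exists_nat_forall_mem_le {α : Type*} {s : Set α} (hs : s.Finite) (u : α → ℕ) :
    ∃ M : ℕ, ∀ a ∈ s, u a ≤ M := by
  obtain ⟨M, hM⟩ := (hs.image u).bddAbove
  exact ⟨M, fun a ha => hM (Set.mem_image_of_mem u ha)⟩

theorem Int.dist_le_natCast_iff {a b : ℤ} {n : ℕ} : dist a b ≤ n ↔ (a - b).natAbs ≤ n := by
  rw [Int.dist_eq', ← Int.natCast_natAbs, Int.cast_natCast]
  exact Nat.cast_le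

/-- A group that is covered by finitely many right translates of an infinite cyclic subgroup is
coarsely equivalent to `ℤ`. -/
theorem coarselyEquivalent_int_of_zpow_mul (hTfin : T.Finite) {z : G} {D : Set G}
    (hz : Function.Injective fun n : ℤ => z ^ n) (hD : D.Finite)
    (hcover : ∀ x, ∃ n : ℤ, ∃ d ∈ D, x = z ^ n * d) :
    CoarselyEquivalent (WordMetricSpace T hT) ℤ := by
  choose f d hd hx using hcover
  have hball := finite_setOf_wordLength_le hTfin hT
  refine ⟨f, ⟨?_, ?_⟩, fun n : ℤ => z ^ n, ⟨?_, ?_⟩, ?_, ?_⟩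
  · refine uniformlyExpansive_of_forall_nat fun n => ?_
    -- As `z ^ (f y - f x) = d x * (x⁻¹ * y) * (d y)⁻¹`, a bounded displacement leaves finitely many
    -- exponents.
    have hfin : (D * {g : G | wordLength T g ≤ n} * D⁻¹).Finite := (hD.mul (hball n)).mul hD.inv
    obtain ⟨M, hM⟩ := exists_nat_forall_mem_le (hfin.preimage hz.injOn) Int.natAbs
    refine ⟨M, fun (x y : G) hxy => ?_⟩
    have hxy' : wordLength T (x⁻¹ * y) ≤ n := (WordMetricSpace.dist_le_natCast_iff x y n).1 hxy
    rw [dist_comm]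
    refine Int.dist_le_natCast_iff.2 (hM _ ⟨d x * (x⁻¹ * y), ⟨d x, hd x, _, hxy', rfl⟩, (d y)⁻¹,
      Set.inv_mem_inv.2 (hd y), ?_⟩)
    have h1 : x * (d x)⁻¹ = z ^ f x := mul_inv_eq_of_eq_mul (hx x)
    have h2 : y * (d y)⁻¹ = z ^ f y := mul_inv_eq_of_eq_mul (hx y)
    show d x * (x⁻¹ * y) * (d y)⁻¹ = z ^ (f y - f x)
    rw [sub_eq_neg_add, zpow_add, zpow_neg, ← h1, ← h2]
    group
  · intro B hB
    refine (WordMetricSpace.isBounded_iff_finite hTfin).2 ?_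
    refine (((Int.isBounded_iff_finite.1 hB).image fun n : ℤ => z ^ n).mul hD).subset ?_
    intro x hxB
    exact ⟨_, ⟨f x, hxB, rfl⟩, d x, hd x, (hx x).symm⟩
  · refine uniformlyExpansive_of_forall_nat fun n => ?_
    obtain ⟨M, hM⟩ := exists_nat_forall_mem_le (Set.finite_Icc (-(n : ℤ)) n)
      fun k => wordLength T (z ^ k)
    refine ⟨M, fun a b hab => ?_⟩
    have hab' := Int.dist_le_natCast_iff.1 hab
    have := hM (-a + b) ⟨by omega, by omega⟩
    rw [zpow_add, zpow_neg] at this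
    exact (WordMetricSpace.dist_le_natCast_iff _ _ M).2 this
  · intro B hB
    exact Int.isBounded_iff_finite.2
      (((WordMetricSpace.isBounded_iff_finite hTfin).1 hB).preimage hz.injOn)
  · obtain ⟨M, hM⟩ := exists_nat_forall_mem_le hD (wordLength T)
    refine ⟨M + 1, by positivity, fun (x : G) => ?_⟩
    have h1 : (z ^ f x)⁻¹ * x = d x := inv_mul_eq_of_eq_mul (hx x)
    have h2 := hM _ (hd x)
    rw [← h1] at h2
    exact ((WordMetricSpace.dist_le_natCast_iff _ x M).2 h2).trans_lt (lt_add_one _)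
  -- Decomposing `z ^ n` itself gives `z ^ (n - f (z ^ n)) ∈ D`, so the error takes finitely many
  -- values.
  · obtain ⟨M, hM⟩ := exists_nat_forall_mem_le (hD.preimage (f := fun n : ℤ => z ^ n) hz.injOn)
      Int.natAbs
    refine ⟨M + 1, by positivity, fun n => ?_⟩
    have h1 : z ^ (-f (z ^ n) + n) ∈ D := by
      rw [zpow_add, zpow_neg, inv_mul_eq_of_eq_mul (hx (z ^ n))]
      exact hd _
    have h2 := hM _ h1
    refine (?_ : dist (f (z ^ n)) n ≤ M).trans_lt (lt_add_one _)
    rw [Int.dist_le_natCast_iff]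
    omega

/-- The metric of `T` enters only through the finiteness of its balls, which turns distance bounds
into finite sets of displacements; this is why `S` and `T` may differ. -/
theorem card_spaceEnds_mulCayley_eq_two_of_coarselyEquivalent [DecidableEq G] {S : Set G}
    (hSfin : S.Finite) (hS : Subgroup.closure S = ⊤) (hTfin : T.Finite)
    (h : CoarselyEquivalent (WordMetricSpace T hT) ℤ) :
    Nat.card (SpaceEnds (graphRealization (SimpleGraph.mulCayley S))) = 2 := by
  obtain ⟨f, ⟨⟨σ, hσ, hfσ⟩, hfp⟩, g, ⟨⟨τ, hτ, hgτ⟩, -⟩, ⟨r, -, hr⟩, r', -, hr'⟩ := h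
  have hball := finite_setOf_wordLength_le hTfin hT
  refine card_spaceEnds_mulCayley_eq_two (f := f) (g := g) hSfin hS ?_ ?_ ?_ ?_ ?_
  · intro Q hQ
    obtain ⟨M, hM⟩ := exists_nat_forall_mem_le hQ (wordLength T)
    obtain ⟨N, hN⟩ := exists_nat_ge (σ M)
    refine ⟨N, fun x q hq => ?_⟩
    have h1 : nndist (α := WordMetricSpace T hT) (x * q : G) x ≤ (M : ℝ≥0) := by
      have h2 : wordLength T (x⁻¹ * (x * q)) ≤ M := by
        rw [inv_mul_cancel_left]
        exact hM q hq
      refine NNReal.coe_le_coe.1 ((dist_comm (α := WordMetricSpace T hT) _ _).trans_le ?_)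
      exact (WordMetricSpace.dist_le_natCast_iff _ _ M).2 h2
    have h3 : dist (f (x * q : G)) (f x) ≤ (N : ℕ) := by
      rw [← coe_nndist]
      exact_mod_cast ((hfσ _ _).trans (hσ h1)).trans hN
    have h4 := Int.dist_le_natCast_iff.1 h3
    rw [abs_le]
    omega
  · intro M
    refine (WordMetricSpace.isBounded_iff_finite hTfin).1
      ((hfp _ (Int.isBounded_iff_finite.2 (Set.finite_Icc (-M) M))).subset fun x hx => ?_)
    exact abs_le.1 hx
  · obtain ⟨N, hN⟩ := exists_nat_ge r
    refine ⟨_, hball N, fun x => ?_⟩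
    exact (WordMetricSpace.dist_le_natCast_iff x (g (f x)) N).1
      ((dist_comm (α := WordMetricSpace T hT) _ _).trans_le ((hr x).le.trans hN))
  · obtain ⟨N, hN⟩ := exists_nat_ge r'
    refine ⟨N, fun n => ?_⟩
    have h1 := Int.dist_le_natCast_iff.1 ((hr' n).le.trans hN)
    have h2 : (f (g n) - n).natAbs ≤ N := h1
    rw [abs_le]
    omega
  · obtain ⟨N, hN⟩ := exists_nat_ge (τ 1)
    refine ⟨_, hball N, fun n => ?_⟩
    have h1 : nndist n (n + 1) ≤ 1 := by
      have h3 : dist n (n + 1) ≤ (1 : ℕ) := Int.dist_le_natCast_iff.2 (by omega)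
      exact_mod_cast h3
    have h2 : dist (g n) (g (n + 1)) ≤ N := by
      rw [← coe_nndist]
      exact_mod_cast ((hgτ _ _).trans (hτ h1)).trans hN
    exact (WordMetricSpace.dist_le_natCast_iff _ _ N).1 h2

end CoarseEquivalenceWithInt

/-! ### The equivalence. -/

theorem lemma4p4 {G : Type*} [Group G]
    (S : Set G) (hSfin : S.Finite) (hS : Subgroup.closure S = ⊤)
    (T : Set G) (hTfin : T.Finite) (hT : Subgroup.closure T = ⊤) :
    Nat.card (SpaceEnds (CayleySpace S)) = 2 ↔
      CoarselyEquivalent (WordMetricSpace T hT) ℤ := by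
  classical
  refine ⟨fun h => ?_,
    card_spaceEnds_mulCayley_eq_two_of_coarselyEquivalent hSfin hS hTfin⟩
  obtain ⟨E, z, hb, hE, hz, hfin⟩ := exists_smul_ssubset hSfin hS h
  exact coarselyEquivalent_int_of_zpow_mul hTfin
    (injective_zpow_iff_not_isOfFinOrder.2 (not_isOfFinOrder_of_smul_ssubset hz)) hfin
    (exists_zpow_mul_of_smul_ssubset hS hb hE hz)
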